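/- Let $N\ge 3$ be an integer, let $q>0$ be a real number with $q\neq 1$, and let the ground field be $\mathbb{R}$ or $\mathbb{C}$. Repeated indices are summed from $1$ to $N$. Write $i'=N+1-i$, and put $\varrho_i=\frac N2-i$ if $i<\frac{N+1}2$, $\varrho_i=0$ if $i=\frac{N+1}2$, and $\varrho_i=\frac N2-i+1$ if $i>\frac{N+1}2$. With $\delta[P]=1$ if $P$ holds and $\delta[P]=0$ otherwise, let $$C^{ij}=C_{ij}=q^{-\varrho_i}\,\delta[i=j'],\qquad K^{kl}_{ij}=C^{ij}C_{kl},$$ $$\hat R^{kl}_{ij}=q^{\delta[k=l]-\delta[k=l']}\,\delta[i=l]\,\delta[j=k]+(q-q^{-1})\,\delta[i<l]\,\bigl(\delta[i=k]\,\delta[j=l]-K^{kl}_{ij}\bigr),$$ $$(\hat R^{-1})^{kl}_{ij}=\hat R^{kl}_{ij}-(q-q^{-1})\,\delta[i=k]\,\delta[j=l]+(q-q^{-1})K^{kl}_{ij}.$$ Let $X$ be the algebra of the quantum Euclidean sphere $\mathrm S_q^{N-1}$, that is, the unital algebra with generators $x_1,\dots,x_N$ and relations $$(\hat R^{-1})^{kl}_{ij}x_kx_l=q^{-1}x_ix_j+\frac{q^{N-1}-q^{N-3}}{1+q^{N-2}}K^{kl}_{ij}x_kx_l,\qquad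 C^{kl}x_kx_l=1 .$$ Let $(\Gamma,\mathrm d)=(\Gamma_+,\mathrm d)$ be the first order differential calculus on $X$ which is the quotient of the universal first order differential calculus by the sub-bimodule generated by the relations $$\mathrm dx_i\cdot x_j=(\hat R^{-1})^{kl}_{ij}x_k\,\mathrm dx_l+(q-1)x_i\,\mathrm dx_j+\frac{q^N-q^{N-2}}{1-q^{N-1}}K^{kl}_{ij}x_k\,\mathrm dx_l+\frac{(1-q)(1+q^{N-2})}{1-q^{N-1}}C^{kl}x_ix_jx_k\,\mathrm dx_l .$$ Put $H=C^{kl}x_k\,\mathrm dx_l$ and $$\gamma^+_i=\mathrm dx_i-\frac{1+q^{N-2}}{1-q^{N-1}}\,x_iH,\qquad \gamma^-_i=\mathrm dx_i+q\,\frac{1+q^{N-2}}{1-q^{N-1}}\,x_iH\qquad(1\le i\le N).$$ Let $\alpha$ be a real number. Then there is exactly one homomorphism of $X$-bimodules $\sigma^+:\Gamma\otimes_X\Gamma\to\Gamma\otimes_X\Gamma$ with $$\sigma^+(\gamma^+_i\otimes_X\gamma^+_j)=\alpha\,(\hat R^{-1})^{kl}_{ij}\,\gamma^+_k\otimes_X\gamma^+_l\quad\text{for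 all } i,j,$$ there is exactly one homomorphism of $X$-bimodules $\sigma^-:\Gamma\otimes_X\Gamma\to\Gamma\otimes_X\Gamma$ with $$\sigma^-(\gamma^-_i\otimes_X\gamma^-_j)=\alpha\,(\hat R^{-1})^{kl}_{ij}\,\gamma^-_k\otimes_X\gamma^-_l\quad\text{for all } i,j,$$ and $\sigma^+=\sigma^-$. -/

import Mathlib

open scoped TensorProduct
open MulOpposite (op)

noncomputable section

set_option linter.unusedSectionVars false

/-! ### The universal first order differential calculus of an algebra -/

section UniversalCalculus

variable (k : Type*) [Field k] (X : Type*) [Ring X] [Algebra k X]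

/-- The enveloping algebra `X ⊗ Xᵒᵖ`; an `X`-bimodule (over `k`) is a left module over it. -/
def Env : Type _ := X ⊗[k] Xᵐᵒᵖ

instance : Ring (Env k X) := inferInstanceAs (Ring (X ⊗[k] Xᵐᵒᵖ))

instance : Algebra k (Env k X) := inferInstanceAs (Algebra k (X ⊗[k] Xᵐᵒᵖ))

/-- `x ↦ x ⊗ 1`, which acts on bimodules as left multiplication by `x`. -/
def envLeft : X →ₐ[k] Env k X :=
  (Algebra.TensorProduct.includeLeft : X →ₐ[k] X ⊗[k] Xᵐᵒᵖ)

/-- `x ↦ 1 ⊗ x`, which acts on bimodules as right multiplication by `x`. -/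
def envRight : Xᵐᵒᵖ →ₐ[k] Env k X :=
  (Algebra.TensorProduct.includeRight : Xᵐᵒᵖ →ₐ[k] X ⊗[k] Xᵐᵒᵖ)

variable {X}

/-- Left multiplication by `x`, as an element of the enveloping algebra. -/
abbrev envL (x : X) : Env k X := envLeft k X x

/-- Right multiplication by `x`, as an element of the enveloping algebra. -/
abbrev envR (x : X) : Env k X := envRight k X (op x)

theorem envL_mul_envR (a b : X) : envL k a * envR k b = (a ⊗ₜ[k] op b : X ⊗[k] Xᵐᵒᵖ) := by
  refine (Algebra.TensorProduct.tmul_mul_tmul (R := k) a 1 (1 : Xᵐᵒᵖ) (op b)).trans ?_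
  rw [mul_one, one_mul]

theorem envR_mul_envL (a b : X) : envR k b * envL k a = envL k a * envR k b := by
  rw [envL_mul_envR]
  refine (Algebra.TensorProduct.tmul_mul_tmul (R := k) 1 a (op b) (1 : Xᵐᵒᵖ)).trans ?_
  rw [mul_one, one_mul]

variable {k} in
theorem Env.induction {p : Env k X → Prop} (h0 : p 0)
    (ht : ∀ a b : X, p (envL k a * envR k b)) (ha : ∀ s t, p s → p t → p (s + t)) (e) : p e := by
  refine TensorProduct.induction_on (R := k) e h0 (fun a b => ?_) ha
  have := ht a b.unop
  rwa [envL_mul_envR, MulOpposite.op_unop] at this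

variable (X)

/-- The multiplication map `a ⊗ b ↦ a * b` on `X ⊗ Xᵒᵖ`. -/
def envMul : Env k X →ₗ[k] X :=
  (TensorProduct.lift
    ((LinearMap.mul k X).compl₂ (MulOpposite.opLinearEquiv k : X ≃ₗ[k] Xᵐᵒᵖ).symm.toLinearMap) :
    X ⊗[k] Xᵐᵒᵖ →ₗ[k] X)

variable {X} in
theorem envMul_apply (a b : X) : envMul k X (envL k a * envR k b) = a * b := by
  rw [envL_mul_envR]; rfl

variable {X} in
theorem envMul_mul (e : Env k X) (a b : X) :
    envMul k X ((envL k a * envR k b) * e) = a * envMul k X e * b := by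
  induction e using Env.induction with
  | h0 => simp
  | ht c d =>
    have h : (envL k a * envR k b) * (envL k c * envR k d) = envL k (a * c) * envR k (d * b) := by
      rw [mul_assoc, ← mul_assoc (envR k b), envR_mul_envL, mul_assoc (envL k c), ← mul_assoc,
        ← map_mul, ← map_mul, ← MulOpposite.op_mul]
    rw [h, envMul_apply, envMul_apply]
    noncomm_ring
  | ha e f he hf => rw [mul_add, map_add, map_add, he, hf]; noncomm_ring

/-- The bimodule of universal one-forms of `X`: the kernel of the multiplication map. -/
def UnivForms : Submodule (Env k X) (Env k X) where
  carrier := {e | envMul k X e = 0}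
  zero_mem' := map_zero _
  add_mem' {a b} ha hb := by
    simp only [Set.mem_ofPred_eq] at ha hb ⊢
    rw [map_add, ha, hb, add_zero]
  smul_mem' c e he := by
    simp only [Set.mem_ofPred_eq] at he ⊢
    induction c using Env.induction with
    | h0 => simp
    | ht a b => rw [smul_eq_mul, envMul_mul, he]; simp
    | ha c d hc hd => rw [add_smul, map_add, hc, hd, add_zero]

/-- The universal differential `x ↦ 1 ⊗ x - x ⊗ 1`. -/
def univD : X →ₗ[k] UnivForms k X where
  toFun x := ⟨envR k x - envL k x, by
    change envMul k X (envR k x - envL k x) = 0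
    have h1 := envMul_apply k 1 x
    have h2 := envMul_apply k x 1
    simp only [envL, envR, map_one, MulOpposite.op_one, one_mul, mul_one] at h1 h2
    rw [map_sub, h1, h2, sub_self]⟩
  map_add' x y := by
    apply Subtype.ext
    simp only [envR, envL, MulOpposite.op_add, map_add, Submodule.coe_add]
    abel
  map_smul' c x := by
    apply Subtype.ext
    simp only [envR, envL, MulOpposite.op_smul, map_smul, RingHom.id_apply]
    exact (smul_sub _ _ _).symm

/-- The bimodule of one-forms of the first order differential calculus on `X` which is the
quotient of the universal one by the sub-bimodule generated by a set `S` of universal one-forms. -/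
def Forms {k : Type*} [Field k] {X : Type*} [Ring X] [Algebra k X]
    (S : Set (UnivForms k X)) : Type _ :=
  UnivForms k X ⧸ Submodule.span (Env k X) S

section Forms

variable {k X} (S : Set (UnivForms k X))

instance : AddCommGroup (Forms S) :=
  inferInstanceAs (AddCommGroup (UnivForms k X ⧸ Submodule.span (Env k X) S))

instance : Module (Env k X) (Forms S) :=
  inferInstanceAs (Module (Env k X) (UnivForms k X ⧸ Submodule.span (Env k X) S))

instance : Module k (Forms S) :=
  inferInstanceAs (Module k (UnivForms k X ⧸ Submodule.span (Env k X) S))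

instance : IsScalarTower k (Env k X) (Forms S) :=
  inferInstanceAs (IsScalarTower k (Env k X) (UnivForms k X ⧸ Submodule.span (Env k X) S))

/-- The quotient map from the universal one-forms. -/
def Forms.mk : UnivForms k X →ₗ[Env k X] Forms S := (Submodule.span (Env k X) S).mkQ

/-- The left action `x • ω = x ω`. -/
instance : Module X (Forms S) :=
  Module.compHom _ (envLeft k X).toRingHom

/-- The right action `op x • ω = ω x`. -/
instance : Module Xᵐᵒᵖ (Forms S) :=
  Module.compHom _ (envRight k X).toRingHom

variable {S}

theorem Forms.smul_eq (x : X) (ω : Forms S) : x • ω = envL k x • ω := rfl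

theorem Forms.op_smul_eq (x : X) (ω : Forms S) : op x • ω = envR k x • ω := rfl

variable (S)

instance : IsScalarTower k X (Forms S) where
  smul_assoc c x ω := by
    rw [Forms.smul_eq, Forms.smul_eq, envL, map_smul, smul_assoc]

instance : IsScalarTower k Xᵐᵒᵖ (Forms S) where
  smul_assoc c x ω := by
    induction x using MulOpposite.rec' with
    | _ x =>
      rw [← MulOpposite.op_smul, Forms.op_smul_eq, Forms.op_smul_eq, envR, MulOpposite.op_smul,
        map_smul, smul_assoc]

instance : SMulCommClass X k (Forms S) := IsScalarTower.to_smulCommClass'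

instance : SMulCommClass Xᵐᵒᵖ k (Forms S) := IsScalarTower.to_smulCommClass'

instance : SMulCommClass X Xᵐᵒᵖ (Forms S) where
  smul_comm x y ω := by
    induction y using MulOpposite.rec' with
    | _ y =>
      rw [Forms.smul_eq, Forms.op_smul_eq, Forms.op_smul_eq, Forms.smul_eq, smul_smul, smul_smul,
        envR_mul_envL]

/-- The differential `d : X → Γ`. -/
def Forms.d : X →ₗ[k] Forms S := (Forms.mk S).restrictScalars k ∘ₗ univD k X

/-- The Leibniz rule `d(xy) = dx · y + x dy`. -/
theorem Forms.d_mul (x y : X) :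
    Forms.d S (x * y) = op y • Forms.d S x + x • Forms.d S y := by
  have h : univD k X (x * y) = envR k y • univD k X x + envL k x • univD k X y := by
    apply Subtype.ext
    simp only [univD, LinearMap.coe_mk, AddHom.coe_mk, Submodule.coe_add, Submodule.coe_smul,
      smul_eq_mul, mul_sub, envR_mul_envL]
    simp only [envR, envL, MulOpposite.op_mul, map_mul]
    abel
  exact (congrArg (Forms.mk S) h).trans (by rw [map_add, map_smul, map_smul]; rfl)

end Forms

end UniversalCalculus

/-! ### Tensor product of bimodules over a noncommutative algebra -/

section BimoduleTensor

variable (k : Type*) [Field k] (X : Type*) [Ring X] [Algebra k X]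
variable (M : Type*) [AddCommGroup M] [Module k M] [Module X M] [Module Xᵐᵒᵖ M]
variable (M' : Type*) [AddCommGroup M'] [Module k M'] [Module X M'] [Module Xᵐᵒᵖ M']

/-- The relations `(m x) ⊗ n = m ⊗ (x n)`. -/
def balancedRel : Submodule k (M ⊗[k] M') :=
  Submodule.span k
    {t | ∃ (m : M) (x : X) (n : M'), t = (op x • m) ⊗ₜ[k] n - m ⊗ₜ[k] (x • n)}

/-- The tensor product `M ⊗_X M'` of two `X`-bimodules. -/
def BTensor : Type _ := (M ⊗[k] M') ⧸ balancedRel k X M M'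

instance : AddCommGroup (BTensor k X M M') :=
  inferInstanceAs (AddCommGroup ((M ⊗[k] M') ⧸ balancedRel k X M M'))

instance : Module k (BTensor k X M M') :=
  inferInstanceAs (Module k ((M ⊗[k] M') ⧸ balancedRel k X M M'))

/-- The quotient map `M ⊗_k M' → M ⊗_X M'`. -/
def BTensor.mk : M ⊗[k] M' →ₗ[k] BTensor k X M M' := (balancedRel k X M M').mkQ

variable {M M'}

/-- The pure tensor `m ⊗_X n`. -/
def btmul (m : M) (n : M') : BTensor k X M M' := BTensor.mk k X M M' (m ⊗ₜ[k] n)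

variable {k X} in
theorem BTensor.induction {p : BTensor k X M M' → Prop} (h0 : p 0)
    (ht : ∀ m n, p (btmul k X m n)) (ha : ∀ s t, p s → p t → p (s + t)) (t) : p t := by
  obtain ⟨t, rfl⟩ : ∃ s, BTensor.mk k X M M' s = t := (balancedRel k X M M').mkQ_surjective t
  induction t using TensorProduct.induction_on with
  | zero => rw [map_zero]; exact h0
  | tmul m n => exact ht m n
  | add s t hs ht => rw [map_add]; exact ha _ _ hs ht

theorem btmul_add_left (m m₁ : M) (n : M') :
    btmul k X (m + m₁) n = btmul k X m n + btmul k X m₁ n := by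
  simp [btmul, TensorProduct.add_tmul]

theorem btmul_add_right (m : M) (n n₁ : M') :
    btmul k X m (n + n₁) = btmul k X m n + btmul k X m n₁ := by
  simp [btmul, TensorProduct.tmul_add]

theorem btmul_zero_left (n : M') : btmul k X (0 : M) n = 0 := by simp [btmul]

theorem btmul_zero_right (m : M) : btmul k X m (0 : M') = 0 := by simp [btmul]

theorem btmul_balanced (m : M) (x : X) (n : M') :
    btmul k X (op x • m) n = btmul k X m (x • n) := by
  rw [← sub_eq_zero, btmul, btmul, ← map_sub]
  exact (Submodule.Quotient.mk_eq_zero _).2 (Submodule.subset_span ⟨m, x, n, rfl⟩)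

variable [SMulCommClass X k M] [SMulCommClass X Xᵐᵒᵖ M]
variable [SMulCommClass Xᵐᵒᵖ k M'] [SMulCommClass X Xᵐᵒᵖ M']

/-- The left action `x (m ⊗ n) = (x m) ⊗ n`. -/
def BTensor.lact (x : X) : BTensor k X M M' →ₗ[k] BTensor k X M M' :=
  Submodule.mapQ _ _ (LinearMap.rTensor M' (DistribSMul.toLinearMap k M x)) (by
    rw [balancedRel, Submodule.span_le]
    rintro _ ⟨m, y, n, rfl⟩
    refine Submodule.subset_span ⟨x • m, y, n, ?_⟩
    simp [smul_comm x (op y) m])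

/-- The right action `(m ⊗ n) x = m ⊗ (n x)`. -/
def BTensor.ract (x : Xᵐᵒᵖ) : BTensor k X M M' →ₗ[k] BTensor k X M M' :=
  Submodule.mapQ _ _ (LinearMap.lTensor M (DistribSMul.toLinearMap k M' x)) (by
    rw [balancedRel, Submodule.span_le]
    rintro _ ⟨m, y, n, rfl⟩
    refine Submodule.subset_span ⟨m, y, x • n, ?_⟩
    simp [smul_comm y x n])

theorem BTensor.lact_btmul (x : X) (m : M) (n : M') :
    BTensor.lact k X x (btmul k X m n) = btmul k X (x • m) n := rfl

theorem BTensor.ract_btmul (x : Xᵐᵒᵖ) (m : M) (n : M') :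
    BTensor.ract k X x (btmul k X m n) = btmul k X m (x • n) := rfl

instance : Module X (BTensor k X M M') where
  smul x t := BTensor.lact k X x t
  smul_zero _ := map_zero _
  smul_add _ := map_add _
  one_smul t := by
    change BTensor.lact k X 1 t = t
    induction t using BTensor.induction with
    | h0 => exact map_zero _
    | ht m n => rw [BTensor.lact_btmul, one_smul]
    | ha s t hs ht => rw [map_add, hs, ht]
  zero_smul t := by
    change BTensor.lact k X 0 t = 0
    induction t using BTensor.induction with
    | h0 => exact map_zero _
    | ht m n => rw [BTensor.lact_btmul, zero_smul, btmul_zero_left]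
    | ha s t hs ht => rw [map_add, hs, ht, add_zero]
  add_smul x y t := by
    change BTensor.lact k X (x + y) t = BTensor.lact k X x t + BTensor.lact k X y t
    induction t using BTensor.induction with
    | h0 => simp
    | ht m n => simp only [BTensor.lact_btmul, add_smul, btmul_add_left]
    | ha s t hs ht => simp only [map_add, hs, ht]; abel
  mul_smul x y t := by
    change BTensor.lact k X (x * y) t = BTensor.lact k X x (BTensor.lact k X y t)
    induction t using BTensor.induction with
    | h0 => simp
    | ht m n => simp only [BTensor.lact_btmul, mul_smul]
    | ha s t hs ht => simp only [map_add, hs, ht]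

instance : Module Xᵐᵒᵖ (BTensor k X M M') where
  smul x t := BTensor.ract k X x t
  smul_zero _ := map_zero _
  smul_add _ := map_add _
  one_smul t := by
    change BTensor.ract k X 1 t = t
    induction t using BTensor.induction with
    | h0 => exact map_zero _
    | ht m n => rw [BTensor.ract_btmul, one_smul]
    | ha s t hs ht => rw [map_add, hs, ht]
  zero_smul t := by
    change BTensor.ract k X 0 t = 0
    induction t using BTensor.induction with
    | h0 => exact map_zero _
    | ht m n => rw [BTensor.ract_btmul, zero_smul, btmul_zero_right]
    | ha s t hs ht => rw [map_add, hs, ht, add_zero]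
  add_smul x y t := by
    change BTensor.ract k X (x + y) t = BTensor.ract k X x t + BTensor.ract k X y t
    induction t using BTensor.induction with
    | h0 => simp
    | ht m n => simp only [BTensor.ract_btmul, add_smul, btmul_add_right]
    | ha s t hs ht => simp only [map_add, hs, ht]; abel
  mul_smul x y t := by
    change BTensor.ract k X (x * y) t = BTensor.ract k X x (BTensor.ract k X y t)
    induction t using BTensor.induction with
    | h0 => simp
    | ht m n => simp only [BTensor.ract_btmul, mul_smul]
    | ha s t hs ht => simp only [map_add, hs, ht]

theorem smul_btmul (x : X) (m : M) (n : M') :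
    x • btmul k X m n = btmul k X (x • m) n := rfl

theorem op_smul_btmul (x : X) (m : M) (n : M') :
    op x • btmul k X m n = btmul k X m (op x • n) := rfl

end BimoduleTensor

/-! ### Structure constants of `O_q(N)` -/

section Constants

variable (N : ℕ) (q : ℝ)

/-- `ϱ_i`; the `0`-based index `i : Fin N` stands for the `1`-based index `i + 1`. -/
def rho (i : Fin N) : ℝ :=
  if 2 * ((i : ℕ) + 1) < N + 1 then (N : ℝ) / 2 - ((i : ℕ) + 1)
  else if 2 * ((i : ℕ) + 1) = N + 1 then 0
  else (N : ℝ) / 2 - ((i : ℕ) + 1) + 1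

/-- `C^{ij} = C_{ij} = q^{-ϱ_i}` if `i = j'`, and `0` otherwise, where `j' = j.rev`. -/
def Cmat (i j : Fin N) : ℝ := if i = j.rev then q ^ (-rho N i) else 0

/-- `K^{kl}_{ij}`. -/
def Kmat (k l i j : Fin N) : ℝ := Cmat N q i j * Cmat N q k l

/-- The identity `I^{kl}_{ij}`. -/
def Imat (k l i j : Fin N) : ℝ := if i = k ∧ j = l then 1 else 0

/-- The R-matrix `R̂^{kl}_{ij}` of `O_q(N)`. -/
def Rmat (k l i j : Fin N) : ℝ :=
  (if i = l ∧ j = k then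
    q ^ ((if k = l then 1 else 0) - (if k = l.rev then 1 else 0) : ℤ) else 0)
  + (if i < l then (q - q⁻¹) * (Imat N k l i j - Kmat N q k l i j) else 0)

/-- The inverse `(R̂⁻¹)^{kl}_{ij}` of the R-matrix, `R̂⁻¹ = R̂ - (q - q⁻¹) I + (q - q⁻¹) K`. -/
def RmatInv (k l i j : Fin N) : ℝ :=
  Rmat N q k l i j - (q - q⁻¹) * Imat N k l i j + (q - q⁻¹) * Kmat N q k l i j

end Constants

/-! ### The quantum Euclidean sphere -/

section Sphere

variable (𝕜 : Type*) [RCLike 𝕜] (N : ℕ) (q : ℝ)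

/-- The defining relations of the algebra of the quantum Euclidean sphere `S_q^{N-1}`. -/
inductive SphereRel : FreeAlgebra 𝕜 (Fin N) → FreeAlgebra 𝕜 (Fin N) → Prop
  | comm (i j : Fin N) : SphereRel
      (∑ k, ∑ l, (RmatInv N q k l i j : 𝕜) • (FreeAlgebra.ι 𝕜 k * FreeAlgebra.ι 𝕜 l))
      (((q⁻¹ : ℝ) : 𝕜) • (FreeAlgebra.ι 𝕜 i * FreeAlgebra.ι 𝕜 j)
        + (((q ^ ((N : ℤ) - 1) - q ^ ((N : ℤ) - 3)) / (1 + q ^ ((N : ℤ) - 2)) : ℝ) : 𝕜) •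
          ∑ k, ∑ l, (Kmat N q k l i j : 𝕜) • (FreeAlgebra.ι 𝕜 k * FreeAlgebra.ι 𝕜 l))
  | radius : SphereRel
      (∑ k, ∑ l, (Cmat N q k l : 𝕜) • (FreeAlgebra.ι 𝕜 k * FreeAlgebra.ι 𝕜 l)) 1

/-- The algebra `X` of the quantum Euclidean sphere `S_q^{N-1}`. -/
def QSphere : Type _ := RingQuot (SphereRel 𝕜 N q)

instance : Ring (QSphere 𝕜 N q) := inferInstanceAs (Ring (RingQuot (SphereRel 𝕜 N q)))

instance : Algebra 𝕜 (QSphere 𝕜 N q) :=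
  inferInstanceAs (Algebra 𝕜 (RingQuot (SphereRel 𝕜 N q)))

/-- The generators `x_i` of the quantum Euclidean sphere. -/
def qx (i : Fin N) : QSphere 𝕜 N q :=
  RingQuot.mkAlgHom 𝕜 (SphereRel 𝕜 N q) (FreeAlgebra.ι 𝕜 i)

end Sphere

/-! ### The first order differential calculus `Γ₊` -/

section Calculus

variable (𝕜 : Type*) [RCLike 𝕜] (N : ℕ) (q : ℝ)

/-- Left-hand side minus right-hand side of the relation
`dx_i · x_j = (R̂⁻¹)^{kl}_{ij} x_k dx_l + (q - 1) x_i dx_j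
  + (q^N - q^{N-2}) / (1 - q^{N-1}) K^{kl}_{ij} x_k dx_l
  + (1 - q) (1 + q^{N-2}) / (1 - q^{N-1}) C^{kl} x_i x_j x_k dx_l`
in the universal one-forms. -/
def gammaRel (i j : Fin N) : UnivForms 𝕜 (QSphere 𝕜 N q) :=
  let x := qx 𝕜 N q
  let du := fun l => univD 𝕜 (QSphere 𝕜 N q) (x l)
  envR 𝕜 (x j) • du i
    - ((∑ k, ∑ l, (RmatInv N q k l i j : 𝕜) • envL 𝕜 (x k) • du l)
      + ((q - 1 : ℝ) : 𝕜) • envL 𝕜 (x i) • du j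
      + (((q ^ (N : ℤ) - q ^ ((N : ℤ) - 2)) / (1 - q ^ ((N : ℤ) - 1)) : ℝ) : 𝕜) •
          (∑ k, ∑ l, (Kmat N q k l i j : 𝕜) • envL 𝕜 (x k) • du l)
      + (((1 - q) * (1 + q ^ ((N : ℤ) - 2)) / (1 - q ^ ((N : ℤ) - 1)) : ℝ) : 𝕜) •
          (∑ k, ∑ l, (Cmat N q k l : 𝕜) • envL 𝕜 (x i * x j * x k) • du l))

/-- The bimodule of one-forms of the covariant first order differential calculus `Γ₊`
on the quantum Euclidean sphere. -/
abbrev Gam : Type _ := Forms (Set.range fun p : Fin N × Fin N => gammaRel 𝕜 N q p.1 p.2)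

/-- The differential `d : X → Γ₊`. -/
abbrev gd : QSphere 𝕜 N q →ₗ[𝕜] Gam 𝕜 N q := Forms.d _

/-- The bimodule relations of `Γ₊`. -/
theorem gd_mul_qx (i j : Fin N) :
    op (qx 𝕜 N q j) • gd 𝕜 N q (qx 𝕜 N q i) =
      (∑ k, ∑ l, (RmatInv N q k l i j : 𝕜) • qx 𝕜 N q k • gd 𝕜 N q (qx 𝕜 N q l))
      + ((q - 1 : ℝ) : 𝕜) • qx 𝕜 N q i • gd 𝕜 N q (qx 𝕜 N q j)
      + (((q ^ (N : ℤ) - q ^ ((N : ℤ) - 2)) / (1 - q ^ ((N : ℤ) - 1)) : ℝ) : 𝕜) •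
          (∑ k, ∑ l, (Kmat N q k l i j : 𝕜) • qx 𝕜 N q k • gd 𝕜 N q (qx 𝕜 N q l))
      + (((1 - q) * (1 + q ^ ((N : ℤ) - 2)) / (1 - q ^ ((N : ℤ) - 1)) : ℝ) : 𝕜) •
          (∑ k, ∑ l, (Cmat N q k l : 𝕜) •
            (qx 𝕜 N q i * qx 𝕜 N q j * qx 𝕜 N q k) • gd 𝕜 N q (qx 𝕜 N q l)) := by
  have h : ((Forms.mk (Set.range fun p : Fin N × Fin N =>
      gammaRel 𝕜 N q p.1 p.2)).restrictScalars 𝕜) (gammaRel 𝕜 N q i j) = 0 :=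
    (Submodule.Quotient.mk_eq_zero _).2 (Submodule.subset_span ⟨(i, j), rfl⟩)
  rw [gammaRel, map_sub, sub_eq_zero] at h
  refine h.trans ?_
  simp only [map_add, map_sum, map_smul]
  rfl

/-- The invariant one-form `H = C^{kl} x_k dx_l`. -/
def Hform : Gam 𝕜 N q :=
  ∑ k, ∑ l, (Cmat N q k l : 𝕜) • qx 𝕜 N q k • gd 𝕜 N q (qx 𝕜 N q l)

/-- `γ⁺_i = dx_i + α⁺ x_i H` with `α⁺ = - (1 + q^{N-2}) / (1 - q^{N-1})`. -/
def gammaP (i : Fin N) : Gam 𝕜 N q :=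
  gd 𝕜 N q (qx 𝕜 N q i)
    + ((-((1 + q ^ ((N : ℤ) - 2)) / (1 - q ^ ((N : ℤ) - 1))) : ℝ) : 𝕜) •
      qx 𝕜 N q i • Hform 𝕜 N q

/-- `γ⁻_i = dx_i + α⁻ x_i H` with `α⁻ = q (1 + q^{N-2}) / (1 - q^{N-1})`. -/
def gammaM (i : Fin N) : Gam 𝕜 N q :=
  gd 𝕜 N q (qx 𝕜 N q i)
    + ((q * ((1 + q ^ ((N : ℤ) - 2)) / (1 - q ^ ((N : ℤ) - 1))) : ℝ) : 𝕜) •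
      qx 𝕜 N q i • Hform 𝕜 N q

/-- The `X`-bimodule `Γ₊ ⊗_X Γ₊`. -/
abbrev Gam2 : Type _ := BTensor 𝕜 (QSphere 𝕜 N q) (Gam 𝕜 N q) (Gam 𝕜 N q)

/-- The pure tensor `ω ⊗_X η` of two one-forms. -/
abbrev gtmul (ω η : Gam 𝕜 N q) : Gam2 𝕜 N q := btmul 𝕜 (QSphere 𝕜 N q) ω η

/-- `σ : Γ₊ ⊗_X Γ₊ → Γ₊ ⊗_X Γ₊` is a homomorphism of `X`-bimodules with
`σ (γ_i ⊗ γ_j) = α (R̂⁻¹)^{kl}_{ij} γ_k ⊗ γ_l` for all `i`, `j`. -/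
structure IsBraidingFor (α : ℝ) (γ : Fin N → Gam 𝕜 N q)
    (σ : Gam2 𝕜 N q →ₗ[𝕜] Gam2 𝕜 N q) : Prop where
  map_left : ∀ (x : QSphere 𝕜 N q) (t : Gam2 𝕜 N q), σ (x • t) = x • σ t
  map_right : ∀ (x : QSphere 𝕜 N q) (t : Gam2 𝕜 N q), σ (op x • t) = op x • σ t
  map_basis : ∀ i j : Fin N, σ (gtmul 𝕜 N q (γ i) (γ j)) =
    (α : 𝕜) • ∑ k, ∑ l, (RmatInv N q k l i j : 𝕜) • gtmul 𝕜 N q (γ k) (γ l)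

end Calculus

end

/-! The core is that Γ is a free left X-module on the γ⁺_i, with γ⁺_i x_j = R̂^{kl}_{ij} x_k γ⁺_l
(`exists_coord_gammaP`, `op_smul_gammaP`). To see this, let x_j act from the right on the free left
module with basis e_i by e_i x_j = R̂^{kl}_{ij} x_k e_l. The braid relation and the compatibility of
R̂ with the metric C make this respect the relations of X. In the resulting bimodule ω = C^{kl} x_k
e_l satisfies ω x_j = q⁻¹ x_j ω + κ e_j with κ ≠ 0, so x ↦ κ⁻¹(ωx − xω) is an inner derivation
sending x_j to e_j + b x_j ω, where bκ = q⁻¹ − 1. These forms obey the relations of Γ, which gives a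
bimodule map from Γ to the free bimodule (`exists_coord`). It sends γ⁺_i to e_i, and since the γ⁺_i
generate Γ from the left it is injective.

Existence of σ⁺: freeness yields a unique left linear map with the prescribed values, and its right
linearity on generators is the braid relation with one R̂ inverted (`kSop_braid_left`). Uniqueness,
for either sign: the γ_i ⊗ γ_j span Γ ⊗_X Γ from the left (`btmul_mem_span`).

Existence of σ⁻ and equality: with ω⁺ = C^{kl} x_k γ⁺_l one has γ⁻_i = γ⁺_i + c x_i ω⁺ for a
constant c such that cκ = −(q − q⁻¹) and (1 + c) q^{N−1} = −q. The values of σ⁺ on γ⁺ ⊗ ω⁺, ω⁺ ⊗ γ⁺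
and ω⁺ ⊗ ω⁺ follow from bimodule linearity, and these two identities make σ⁺ satisfy the defining
equation of σ⁻ (`IsBraidingFor.gammaM`).

The identities for R̂ used on the way (C is an eigenvector, the quadratic relation, the braid
relation) are proved by induction from N to N + 2: without its first and last index, the R-matrix of
size N + 2 is the one of size N up to a metric term. -/

noncomputable section

set_option linter.unusedSectionVars false

/-! ### The R-matrix as an operator, and its blocks under N → N + 2. -/

section Structure

variable {N : ℕ} (q : ℝ) {E : Type*} [AddCommGroup E] [Module ℝ E]

/-- The operator of the R-matrix on families with two indices. -/
def Rop (f : Fin N → Fin N → E) (i j : Fin N) : E := ∑ k, ∑ l, Rmat N q k l i j • f k l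

/-- The operator of the inverse R-matrix on families with two indices. -/
def Sop (f : Fin N → Fin N → E) (i j : Fin N) : E := ∑ k, ∑ l, RmatInv N q k l i j • f k l

/-- The contraction of a family with two indices by the metric. -/
def Ctr (f : Fin N → Fin N → E) : E := ∑ k, ∑ l, Cmat N q k l • f k l

theorem rho_rev (i : Fin N) : rho N i.rev = -rho N i := by
  have h := i.isLt
  have e : ((i.rev : ℕ) : ℝ) = N - 1 - i := by
    rw [Fin.val_rev, Nat.cast_sub (by omega)]; push_cast; ring
  unfold rho
  rw [e, Fin.val_rev]
  split_ifs <;> first | omega | ring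

theorem rho_zero : rho (N + 2) 0 = N / 2 := by
  simp [rho]; ring

theorem rho_last : rho (N + 2) (Fin.last (N + 1)) = -(N / 2) := by
  rw [← rho_zero, ← rho_rev, Fin.rev_zero]

theorem rho_mid (i : Fin N) : rho (N + 2) i.castSucc.succ = rho N i := by
  unfold rho
  simp only [Fin.val_succ, Fin.val_castSucc]
  push_cast
  split_ifs <;> first | omega | ring

theorem Cmat_rev (i : Fin N) : Cmat N q i i.rev = q ^ (-rho N i) := by simp [Cmat]

theorem Ctr_eq (f : Fin N → Fin N → E) : Ctr q f = ∑ l, q ^ (-rho N l) • f l l.rev := by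
  unfold Ctr
  refine Finset.sum_congr rfl fun k _ => ?_
  rw [Finset.sum_eq_single k.rev]
  · rw [Cmat_rev]
  · intro b _ hb
    rw [Cmat, if_neg, zero_smul]
    rintro rfl; simp at hb
  · simp

/-- The working form of R̂: a weighted flip, a diagonal part and a metric part. The metric sum is
truncated to i < l, which is what makes the block formulas below asymmetric in the first and last
index. -/
theorem Rop_eq (f : Fin N → Fin N → E) (i j : Fin N) : Rop q f i j =
    q ^ ((if i = j then 1 else 0) - (if i = j.rev then 1 else 0) : ℤ) • f j i
    + (if i < j then (q - q⁻¹) • f i j else 0)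
    - ((q - q⁻¹) * Cmat N q i j) •
      ∑ l : Fin N, if i < l then q ^ (-rho N l.rev) • f l.rev l else 0 := by
  have e : ∀ k l, Rmat N q k l i j • f k l =
      (if k = j then if l = i then
        q ^ ((if i = j then 1 else 0) - (if i = j.rev then 1 else 0) : ℤ) • f k l else 0 else 0)
      + (if k = i then if l = j then if i < j then (q - q⁻¹) • f k l else 0 else 0 else 0)
      - ((q - q⁻¹) * Cmat N q i j) •
        (if k = l.rev then if i < l then q ^ (-rho N l.rev) • f k l else 0 else 0) := by
    intro k l
    unfold Rmat
    rw [add_smul, add_sub_assoc]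
    congr 1
    · by_cases hk : k = j
      · by_cases hl : l = i
        · subst hk hl
          have : (k = l.rev) = (l = k.rev) := by
            rw [eq_iff_iff]; exact Fin.rev_eq_iff.symm.trans eq_comm
          simp [eq_comm (a := k) (b := l), this]
        · simp [hl, Ne.symm hl]
      · simp [hk, Ne.symm hk]
    · unfold Imat Kmat
      by_cases hl : i < l
      · rw [if_pos hl, if_pos hl, mul_sub, sub_smul]
        congr 1
        · by_cases h1 : k = i <;> by_cases h2 : l = j
          · subst h1 h2; simp [hl]
          · simp [h2, Ne.symm h2]
          · simp [h1, Ne.symm h1]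
          · simp [h1, Ne.symm h1]
        · rw [← mul_assoc, mul_smul]
          congr 1
          unfold Cmat
          by_cases h : k = l.rev
          · subst h; simp
          · simp [h]
      · rw [if_neg hl, if_neg hl, zero_smul]
        by_cases h1 : l = j
        · subst h1; simp [hl]
        · simp [h1]
  unfold Rop
  simp only [e, Finset.sum_add_distrib, Finset.sum_sub_distrib]
  congr 1
  · simp
  · rw [Finset.sum_comm]
    simp [Finset.smul_sum]

theorem Rop_add (f g : Fin N → Fin N → E) (i j : Fin N) :
    Rop q (fun a b => f a b + g a b) i j = Rop q f i j + Rop q g i j := by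
  simp [Rop, Finset.sum_add_distrib]

theorem Rop_sub (f g : Fin N → Fin N → E) (i j : Fin N) :
    Rop q (fun a b => f a b - g a b) i j = Rop q f i j - Rop q g i j := by
  simp [Rop, smul_sub, Finset.sum_sub_distrib]

theorem Rop_smul (c : ℝ) (f : Fin N → Fin N → E) (i j : Fin N) :
    Rop q (fun a b => c • f a b) i j = c • Rop q f i j := by
  simp only [Rop, Finset.smul_sum, smul_comm c]

theorem Ctr_add (f g : Fin N → Fin N → E) :
    Ctr q (fun a b => f a b + g a b) = Ctr q f + Ctr q g := by
  simp [Ctr, Finset.sum_add_distrib]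

theorem Ctr_sub (f g : Fin N → Fin N → E) :
    Ctr q (fun a b => f a b - g a b) = Ctr q f - Ctr q g := by
  simp [Ctr, smul_sub, Finset.sum_sub_distrib]

theorem Ctr_smul (c : ℝ) (f : Fin N → Fin N → E) :
    Ctr q (fun a b => c • f a b) = c • Ctr q f := by
  simp only [Ctr, Finset.smul_sum, smul_comm c]

theorem Sop_eq (f : Fin N → Fin N → E) (i j : Fin N) : Sop q f i j =
    Rop q f i j - (q - q⁻¹) • f i j + ((q - q⁻¹) * Cmat N q i j) • Ctr q f := by
  unfold Sop Rop Ctr RmatInv Kmat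
  simp only [add_smul, sub_smul, Finset.sum_add_distrib, Finset.sum_sub_distrib]
  congr 1
  · congr 1
    have : ∀ k l, ((q - q⁻¹) * Imat N k l i j) • f k l =
        if k = i then if l = j then (q - q⁻¹) • f k l else 0 else 0 := by
      intro k l
      unfold Imat
      by_cases h1 : k = i <;> by_cases h2 : l = j
      · subst h1 h2; simp
      · simp [h2, Ne.symm h2]
      · simp [h1, Ne.symm h1]
      · simp [h1, Ne.symm h1]
    simp [this, sub_smul]
  · simp only [Finset.smul_sum, smul_smul, mul_assoc]

/-! Splitting off the first and the last index. -/

theorem Fin.eq_zero_or_mid_or_last (i : Fin (N + 2)) :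
    i = 0 ∨ (∃ v : Fin N, i = v.castSucc.succ) ∨ i = Fin.last (N + 1) := by
  induction i using Fin.cases with
  | zero => exact .inl rfl
  | succ i =>
    induction i using Fin.lastCases with
    | last => exact .inr (.inr rfl)
    | cast v => exact .inr (.inl ⟨v, rfl⟩)

theorem Fin.sum_zero_mid_last {A : Type*} [AddCommMonoid A] (g : Fin (N + 2) → A) :
    ∑ i, g i = g 0 + ∑ v : Fin N, g v.castSucc.succ + g (Fin.last (N + 1)) := by
  rw [Fin.sum_univ_succ, Fin.sum_univ_castSucc, ← add_assoc]; rfl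

theorem Fin.rev_mid (v : Fin N) : (v.castSucc.succ).rev = (v.rev).castSucc.succ := by
  ext; simp [Fin.val_rev]; omega

theorem Fin.mid_ne_zero (v : Fin N) : v.castSucc.succ ≠ 0 := Fin.succ_ne_zero _

theorem Fin.mid_ne_last (v : Fin N) : v.castSucc.succ ≠ Fin.last (N + 1) := by
  intro h
  have h' : (v : ℕ) + 1 = N + 1 := congrArg Fin.val h
  have := v.isLt
  omega

theorem Fin.mid_lt_last (v : Fin N) : v.castSucc.succ < Fin.last (N + 1) :=
  lt_of_le_of_ne (Fin.le_last _) (Fin.mid_ne_last v)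

theorem Fin.zero_ne_last' : (0 : Fin (N + 2)) ≠ Fin.last (N + 1) := by
  intro h; have := congrArg Fin.val h; simp at this

theorem Ctr_succ (f : Fin (N + 2) → Fin (N + 2) → E) : Ctr q f =
    q ^ (-(N / 2 : ℝ)) • f 0 (Fin.last _) + q ^ (N / 2 : ℝ) • f (Fin.last _) 0
    + Ctr q (fun a b : Fin N => f a.castSucc.succ b.castSucc.succ) := by
  rw [Ctr_eq, Ctr_eq, Fin.sum_zero_mid_last]
  simp only [rho_zero, rho_last, rho_mid, Fin.rev_mid, Fin.rev_zero, Fin.rev_last, neg_neg]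
  abel

theorem Rop_zero_zero (f : Fin (N + 2) → Fin (N + 2) → E) : Rop q f 0 0 = q • f 0 0 := by
  simp [Rop_eq, Cmat, Fin.rev_zero]

theorem Rop_zero_mid (f : Fin (N + 2) → Fin (N + 2) → E) (v : Fin N) :
    Rop q f 0 v.castSucc.succ = f v.castSucc.succ 0 + (q - q⁻¹) • f 0 v.castSucc.succ := by
  simp [Rop_eq, Cmat, (Fin.mid_ne_zero _).symm, Fin.rev_mid]

theorem Rop_zero_last (f : Fin (N + 2) → Fin (N + 2) → E) : Rop q f 0 (Fin.last _) =
    q⁻¹ • f (Fin.last _) 0 + (q - q⁻¹) • f 0 (Fin.last _)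
    - ((q - q⁻¹) * q ^ (-(N / 2 : ℝ))) • (q ^ (-(N / 2 : ℝ)) • f 0 (Fin.last _)
      + Ctr q (fun a b : Fin N => f a.castSucc.succ b.castSucc.succ)) := by
  rw [Rop_eq, Ctr_eq, Fin.sum_zero_mid_last]
  -- The metric sum of `Rop_eq` is indexed by the second slot and `Ctr_eq` by the first; reversal
  -- matches them.
  rw [← Equiv.sum_comp Fin.revPerm (fun v : Fin N => if (0 : Fin (N + 2)) < v.castSucc.succ then _ else _)]
  simp [Cmat, Fin.rev_last, Fin.rev_mid, rho_zero, rho_mid, Fin.succ_pos, Fin.last_pos]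
  rw [add_comm (_ • Finset.sum _ _)]

theorem Rop_mid_zero (f : Fin (N + 2) → Fin (N + 2) → E) (v : Fin N) :
    Rop q f v.castSucc.succ 0 = f 0 v.castSucc.succ := by
  simp [Rop_eq, Cmat, Fin.rev_zero]

/-- The correction to the smaller R-matrix is the summand l = N + 2 (1-based) of the truncated
metric sum; it is always present because a middle index is below the last one, whereas l = 1 never
occurs. -/
theorem Rop_mid_mid (f : Fin (N + 2) → Fin (N + 2) → E) (v w : Fin N) :
    Rop q f v.castSucc.succ w.castSucc.succ =
      Rop q (fun a b : Fin N => f a.castSucc.succ b.castSucc.succ) v w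
      - (q - q⁻¹) • q ^ (-(N / 2 : ℝ)) • Cmat N q v w • f 0 (Fin.last _) := by
  rw [Rop_eq, Rop_eq, Fin.sum_zero_mid_last]
  simp [Cmat, Fin.rev_last, Fin.rev_mid, rho_zero, rho_mid, Fin.mid_lt_last,
    Fin.castSucc_inj, Fin.succ_inj]
  split_ifs <;> simp [smul_smul] <;> module

theorem Rop_mid_last (f : Fin (N + 2) → Fin (N + 2) → E) (v : Fin N) :
    Rop q f v.castSucc.succ (Fin.last _) =
      f (Fin.last _) v.castSucc.succ + (q - q⁻¹) • f v.castSucc.succ (Fin.last _) := by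
  simp [Rop_eq, Cmat, Fin.mid_lt_last]

theorem Rop_last_zero (f : Fin (N + 2) → Fin (N + 2) → E) :
    Rop q f (Fin.last _) 0 = q⁻¹ • f 0 (Fin.last _) := by
  simp [Rop_eq, Cmat, Fin.zero_ne_last'.symm, Fin.rev_zero, not_lt_of_ge (Fin.le_last _)]

theorem Rop_last_mid (f : Fin (N + 2) → Fin (N + 2) → E) (v : Fin N) :
    Rop q f (Fin.last _) v.castSucc.succ = f v.castSucc.succ (Fin.last _) := by
  simp [Rop_eq, Cmat, (Fin.mid_ne_last _).symm, Fin.rev_mid, not_lt_of_ge (Fin.le_last _)]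

theorem Rop_last_last (f : Fin (N + 2) → Fin (N + 2) → E) :
    Rop q f (Fin.last _) (Fin.last _) = q • f (Fin.last _) (Fin.last _) := by
  simp [Rop_eq, Cmat, Fin.zero_ne_last'.symm, not_lt_of_ge (Fin.le_last _)]

end Structure

/-! ### Crossing symmetry between the R-matrix, its inverse and the metric. -/

section Structure

variable {N : ℕ} {q : ℝ} {E : Type*} [AddCommGroup E] [Module ℝ E]

/-- Together with `RmatInv_rev_eq` this brings both sides of `Rmat_slide` to the same shape: they
differ only in the exponent of q in the flip term and in the condition m < j versus ¬ j < m. -/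
theorem Rmat_rev_eq (hq : 0 < q) (k m n j : Fin N) :
    q ^ (-rho N k) * Rmat N q m n k.rev j =
      (if j = m ∧ k = n.rev then
        q ^ (-rho N k) * q ^ ((if m = n then 1 else 0) - (if m = n.rev then 1 else 0) : ℤ) else 0)
      + if m < j then (q - q⁻¹) * ((if j = n ∧ k = m.rev then q ^ (-rho N k) else 0)
          - (if j = k ∧ m = n.rev then q ^ rho N n else 0)) else 0 := by
  have e1 : ∀ a b : Fin N, (a.rev = b) = (a = b.rev) := fun a b => by
    rw [eq_iff_iff, Fin.rev_eq_iff]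
  have e2 : q ^ rho N k * q ^ (-rho N k) = 1 := by
    rw [← Real.rpow_add hq, add_neg_cancel, Real.rpow_zero]
  unfold Rmat Kmat Imat Cmat
  simp only [Fin.rev_rev, rho_rev, e1, mul_add, mul_ite, mul_zero, neg_neg]
  congr 1
  · simp only [and_comm]
  · by_cases hC : j = n ∧ k = m.rev
    · obtain ⟨rfl, rfl⟩ := hC
      by_cases h : m = j.rev
      · subst h
        simp only [rho_rev, Fin.rev_rev, neg_neg, if_true, and_self] at e2 ⊢
        split_ifs
        · linear_combination (-(q - q⁻¹) * q ^ rho N j) * e2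
        · rfl
      · have h' : ¬ j = m.rev := fun h2 => h (by rw [h2, Fin.rev_rev])
        simp [h, h', mul_comm]
    · have hC' : ¬ (k = m.rev ∧ j = n) := fun h => hC h.symm
      by_cases hB : j = k ∧ m = n.rev
      · obtain ⟨rfl, rfl⟩ := hB
        have : j.rev < n ↔ n.rev < j := Fin.rev_lt_iff
        simp only [hC, hC', this, if_true, if_false, and_self, rho_rev, neg_neg]
        split_ifs
        · linear_combination (-(q - q⁻¹) * q ^ rho N n) * e2
        · rfl
      · simp [hC, hC', hB]
        exact fun _ h1 h2 => absurd ⟨h2.symm, h1⟩ hB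

theorem RmatInv_rev_eq (hq : 0 < q) (k m n j : Fin N) :
    q ^ rho N n * RmatInv N q k m j n.rev =
      (if j = m ∧ k = n.rev then
        q ^ rho N n * q ^ ((if k = m then 1 else 0) - (if k = m.rev then 1 else 0) : ℤ) else 0)
      + if ¬ j < m then (q - q⁻¹) * ((if j = n ∧ k = m.rev then q ^ (-rho N k) else 0)
          - (if j = k ∧ m = n.rev then q ^ rho N n else 0)) else 0 := by
  have e1 : ∀ a b : Fin N, (a.rev = b) = (a = b.rev) := fun a b => by
    rw [eq_iff_iff, Fin.rev_eq_iff]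
  have e2 : q ^ rho N n * q ^ (-rho N n) = 1 := by
    rw [← Real.rpow_add hq, add_neg_cancel, Real.rpow_zero]
  have e3 : (n = k.rev) = (k = n.rev) := by rw [eq_iff_iff, eq_comm, Fin.rev_eq_iff]
  have e4 : (n = m.rev) = (m = n.rev) := by rw [eq_iff_iff, eq_comm, Fin.rev_eq_iff]
  have e5 : (if j = n then q ^ (-rho N j) else 0) * (if k = m.rev then q ^ (-rho N k) else 0)
      * q ^ rho N n = if j = n ∧ k = m.rev then q ^ (-rho N k) else 0 := by
    by_cases h : j = n
    · subst h
      by_cases h' : k = m.rev <;> simp only [h', if_true, if_false, and_self, and_false]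
      · linear_combination q ^ (-rho N m.rev) * e2
      · ring
    · simp [h]
  unfold RmatInv Rmat Kmat Imat Cmat
  simp only [Fin.rev_rev, e1, e3, e4]
  rw [← e5, ite_not]
  generalize (if j = n then q ^ (-rho N j) else 0) * (if k = m.rev then q ^ (-rho N k) else 0) = p
  generalize q ^ ((if k = m then 1 else 0) - (if k = m.rev then 1 else 0) : ℤ) = z
  split_ifs <;> ring

/-- For j ≠ m the two conditions on the off-diagonal bracket are equivalent and the flip terms
vanish. For j = m the flip exponents are opposite, and the bracket, now present on the right only,
supplies the difference q − q⁻¹ up to sign. -/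
theorem Rmat_slide (hq : 0 < q) (k m n j : Fin N) :
    q ^ (-rho N k) * Rmat N q m n k.rev j = q ^ rho N n * RmatInv N q k m j n.rev := by
  rw [Rmat_rev_eq hq, RmatInv_rev_eq hq]
  have e1 : ∀ a b : Fin N, (a.rev = b) = (a = b.rev) := fun a b => by
    rw [eq_iff_iff, Fin.rev_eq_iff]
  by_cases hA : j = m ∧ k = n.rev
  · obtain ⟨rfl, rfl⟩ := hA
    simp only [Fin.rev_rev, rho_rev, e1, lt_irrefl, neg_neg, if_true, if_false,
      not_false_iff, and_self]
    by_cases h1 : j = n <;> by_cases h2 : j = n.rev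
    · have h3 : n = n.rev := h1.symm.trans h2
      simp [h1, ← h3]
    · subst h1
      simp [h2]; ring
    · subst h2
      simp [h1, Ne.symm h1]; ring
    · have h3 : ¬ n = j.rev := fun h => h2 (by rw [h, Fin.rev_rev])
      simp [h1, h2, h3, Ne.symm h1]
  · simp only [hA, if_false, zero_add]
    by_cases h : j = m
    · subst h
      have hB : ¬ (j = k ∧ j = n.rev) := fun h => hA ⟨rfl, by rw [← h.1, h.2]⟩
      have hC : ¬ (j = n ∧ k = j.rev) := fun h => hA ⟨rfl, by rw [h.2, h.1]⟩
      simp [hB, hC]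
    · have : m < j ↔ ¬ j < m := by
        rw [not_lt]; exact ⟨le_of_lt, fun h' => lt_of_le_of_ne h' (Ne.symm h)⟩
      simp only [this]

/-- Moving a strand through the metric turns the R-matrix into its inverse. -/
theorem Ctr_Rop_slide (hq : 0 < q) (f : Fin N → Fin N → Fin N → E) (j : Fin N) :
    Ctr q (fun k l => Rop q (fun m n => f k m n) l j) =
      Ctr q (fun l n => Sop q (fun k m => f k m n) j l) := by
  rw [Ctr_eq, Ctr_eq, ← Equiv.sum_comp Fin.revPerm (fun l => _ • Sop q _ j l)]
  simp only [Fin.revPerm_apply, Fin.rev_rev, rho_rev, neg_neg, Rop, Sop, Finset.smul_sum,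
    smul_smul, Rmat_slide hq]
  have := fun k => Finset.sum_comm (s := Finset.univ) (t := Finset.univ)
    (f := fun m n => (q ^ rho N n * RmatInv N q k m j n.rev) • f k m n)
  rw [Finset.sum_congr rfl fun k _ => this k, Finset.sum_comm]

theorem Cmat_apply (k l : Fin N) : Cmat N q k l = if l = k.rev then q ^ (-rho N k) else 0 := by
  have : (k = l.rev) = (l = k.rev) := by rw [eq_iff_iff, eq_comm, Fin.rev_eq_iff]
  rw [Cmat]; simp only [this]

/-- The metric is its own inverse, because ϱ changes sign under j ↦ j'. -/
theorem Ctr_Cmat_left (hq : 0 < q) (f : Fin N → E) (j : Fin N) :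
    Ctr q (fun k l => Cmat N q l j • f k) = f j := by
  rw [Ctr_eq, Finset.sum_eq_single j]
  · rw [smul_smul, Cmat, if_pos rfl, ← Real.rpow_add hq, rho_rev, neg_neg, neg_add_cancel,
      Real.rpow_zero, one_smul]
  · intro b _ hb
    rw [Cmat, if_neg (by simpa using hb), zero_smul, smul_zero]
  · simp

theorem Ctr_Cmat_right (hq : 0 < q) (f : Fin N → E) (j : Fin N) :
    Ctr q (fun l n => Cmat N q j l • f n) = f j := by
  rw [Ctr_eq, Finset.sum_eq_single j.rev]
  · rw [smul_smul, Cmat_apply, if_pos rfl, ← Real.rpow_add hq, rho_rev, neg_neg, add_neg_cancel,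
      Real.rpow_zero, one_smul, Fin.rev_rev]
  · intro b _ hb
    rw [Cmat_apply, if_neg hb, zero_smul, smul_zero]
  · simp

/-- R̂⁻¹ differs from R̂ by multiples of I and K, and the slide interchanges these two corrections,
so the version for R̂ implies this one. -/
theorem Ctr_Sop_slide (hq : 0 < q) (f : Fin N → Fin N → Fin N → E) (j : Fin N) :
    Ctr q (fun k l => Sop q (fun m n => f k m n) l j) =
      Ctr q (fun l n => Rop q (fun k m => f k m n) j l) := by
  have h := Ctr_Rop_slide hq f j
  simp only [Sop_eq, Ctr_add, Ctr_sub, Ctr_smul, mul_smul] at h ⊢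
  rw [Ctr_Cmat_right hq (fun n => Ctr q fun k m => f k m n)] at h
  rw [Ctr_Cmat_left hq (fun k => Ctr q fun m n => f k m n), h]
  abel

theorem Rmat_symm (k l i j : Fin N) : Rmat N q k l i j = Rmat N q i j k l := by
  unfold Rmat Imat Kmat
  congr 1
  · by_cases h : i = l ∧ j = k
    · obtain ⟨rfl, rfl⟩ := h
      simp
      congr 2
      · simp [eq_comm]
      · have : (j = i.rev) = (i = j.rev) := by rw [eq_iff_iff, eq_comm, Fin.rev_eq_iff]
        simp [this]
    · have : ¬ (k = j ∧ l = i) := fun h' => h ⟨h'.2.symm, h'.1.symm⟩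
      rw [if_neg h, if_neg this]
  · by_cases h : i = k ∧ j = l
    · obtain ⟨rfl, rfl⟩ := h; rfl
    · have h' : ¬ (k = i ∧ l = j) := fun h' => h ⟨h'.1.symm, h'.2.symm⟩
      rw [if_neg h, if_neg h']
      unfold Cmat
      by_cases h1 : i = j.rev <;> by_cases h2 : k = l.rev <;> simp [h1, h2]
      have : j.rev < l ↔ l.rev < j := Fin.rev_lt_iff
      simp only [this, mul_comm]

end Structure

/-! ### Trace of the metric, its eigenvalue under R̂, and the quadratic relation. -/

section Structure

variable {N : ℕ} {q : ℝ} {E : Type*} [AddCommGroup E] [Module ℝ E]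

/-- With s = q^{−N/2} all coefficients in the induction become rational functions of q and s. -/
theorem exists_sqrt_pow (hq : 0 < q) (N : ℕ) : ∃ s : ℝ, s ≠ 0 ∧ (q ^ N)⁻¹ = s ^ 2 ∧
    q ^ (-(N / 2 : ℝ)) = s ∧ q ^ (N / 2 : ℝ) = s⁻¹ := by
  refine ⟨q ^ (-(N / 2 : ℝ)), (Real.rpow_pos_of_pos hq _).ne', ?_, rfl, ?_⟩
  · rw [← Real.rpow_natCast q N, ← Real.rpow_neg hq.le, ← Real.rpow_mul_natCast hq.le]
    congr 1; push_cast; ring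
  · rw [Real.rpow_neg hq.le, inv_inv]

theorem Rop_fin_one (f : Fin 1 → Fin 1 → E) (i j : Fin 1) : Rop q f i j = f i j := by
  obtain rfl := Subsingleton.elim i 0
  obtain rfl := Subsingleton.elim j 0
  simp [Rop_eq]

theorem Ctr_fin_one (f : Fin 1 → Fin 1 → E) : Ctr q f = f 0 0 := by
  simp [Ctr_eq, rho]

theorem Cmat_zero_zero : Cmat (N + 2) q 0 0 = 0 := by
  simp [Cmat, Fin.rev_zero]

theorem Cmat_zero_mid (v : Fin N) : Cmat (N + 2) q 0 v.castSucc.succ = 0 := by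
  rw [Cmat, Fin.rev_mid, if_neg (Fin.mid_ne_zero _).symm]

theorem Cmat_zero_last : Cmat (N + 2) q 0 (Fin.last _) = q ^ (-(N / 2 : ℝ)) := by
  simp [Cmat, rho_zero]

theorem Cmat_mid_zero (v : Fin N) : Cmat (N + 2) q v.castSucc.succ 0 = 0 := by
  rw [Cmat, Fin.rev_zero, if_neg (Fin.mid_ne_last _)]

theorem Cmat_mid_mid (v w : Fin N) :
    Cmat (N + 2) q v.castSucc.succ w.castSucc.succ = Cmat N q v w := by
  simp [Cmat, Fin.rev_mid, rho_mid]

theorem Cmat_mid_last (v : Fin N) : Cmat (N + 2) q v.castSucc.succ (Fin.last _) = 0 := by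
  rw [Cmat, Fin.rev_last, if_neg (Fin.mid_ne_zero _)]

theorem Cmat_last_zero : Cmat (N + 2) q (Fin.last _) 0 = q ^ (N / 2 : ℝ) := by
  simp [Cmat, rho_last, Fin.rev_zero]

theorem Cmat_last_mid (v : Fin N) : Cmat (N + 2) q (Fin.last _) v.castSucc.succ = 0 := by
  rw [Cmat, Fin.rev_mid, if_neg (Fin.mid_ne_last _).symm]

theorem Cmat_last_last : Cmat (N + 2) q (Fin.last _) (Fin.last _) = 0 := by
  simp [Cmat]

/-- The trace C^{kl}C_{kl} grows by q^N + q^{−N} at each step N → N + 2; the factor q − q⁻¹ clears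
the denominator of the geometric sum. -/
theorem mul_Ctr_Cmat (hq : 0 < q) (N : ℕ) :
    (q - q⁻¹) * Ctr q (fun k l : Fin N => Cmat N q k l) =
      q - q⁻¹ + q⁻¹ * q ^ N - q * (q ^ N)⁻¹ := by
  induction N using Nat.twoStepInduction with
  | zero => simp [Ctr]
  | one => rw [Ctr_fin_one]; simp [Cmat, rho]; field_simp; ring
  | more N ih _ =>
    obtain ⟨s, hs, h1, h2, h3⟩ := exists_sqrt_pow hq N
    have e2 : q ^ N = (s ^ 2)⁻¹ := by rw [← h1, inv_inv]
    rw [Ctr_succ]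
    simp only [Cmat_mid_mid, mul_add, ih]
    simp only [Cmat_zero_last, Cmat_last_zero, h2, h3,
      pow_add, e2, smul_eq_mul]
    field_simp
    ring

theorem Ctr_Cmat_smul (h : E) :
    Ctr q (fun v w : Fin N => Cmat N q v w • h) =
      (Ctr q (fun v w : Fin N => Cmat N q v w)) • h := by
  simp only [Ctr, Finset.sum_smul, smul_smul, smul_eq_mul]

/-- The metric is an eigenvector of the R-matrix. -/
theorem Ctr_Rop (hq : 0 < q) (f : Fin N → Fin N → E) :
    Ctr q (Rop q f) = (q * (q ^ N)⁻¹) • Ctr q f := by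
  induction N using Nat.twoStepInduction with
  | zero => simp [Ctr]
  | one => simp [Ctr_fin_one, Rop_fin_one, mul_inv_cancel₀ hq.ne']
  | more N ih _ =>
    obtain ⟨s, hs, h1, h2, h3⟩ := exists_sqrt_pow hq N
    have h4 : (q ^ (N + 2))⁻¹ = s ^ 2 * (q ^ 2)⁻¹ := by rw [pow_add, mul_inv, h1]
    have e2 : q ^ N = (s ^ 2)⁻¹ := by rw [← h1, inv_inv]
    have ht := mul_Ctr_Cmat hq N
    rw [Ctr_succ, Ctr_succ, Rop_zero_last, Rop_last_zero]
    -- The metric corrections of the middle block, once contracted, contribute the trace of the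
    -- smaller metric, whose value is `ht`.
    simp only [Rop_mid_mid, Ctr_sub, Ctr_smul, Ctr_Cmat_smul]
    rw [show Ctr q (fun a b : Fin N => Rop q (fun a b : Fin N => f a.castSucc.succ b.castSucc.succ)
      a b) = _ from ih _]
    simp only [h2, h3, h4, e2] at ht ⊢
    generalize Ctr q (fun v w : Fin N => Cmat N q v w) = t at ht
    have hq0 : q ≠ 0 := hq.ne'
    match_scalars
    · field_simp
    · field_simp at ht ⊢
      linear_combination (-1) * ht
    · field_simp; ring

/-- The transpose of `Ctr_Rop`: test it on a family supported at (i, j) and use the symmetry of the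
matrix R̂. -/
theorem Rop_Cmat (hq : 0 < q) (h : E) (i j : Fin N) :
    Rop q (fun a b => Cmat N q a b • h) i j = (q * (q ^ N)⁻¹) • Cmat N q i j • h := by
  have := Ctr_Rop hq (fun k l => if k = i ∧ l = j then h else 0)
  have e : ∀ g : Fin N → Fin N → ℝ, ∑ k, ∑ l, g k l • (if k = i ∧ l = j then h else 0) =
      g i j • h := by
    intro g
    rw [Finset.sum_eq_single i, Finset.sum_eq_single j]
    · simp
    · intro b _ hb; simp [hb]
    · simp
    · intro b _ hb; simp [hb]
    · simp
  simp only [Ctr, Rop, e] at this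
  rw [← this, Rop]
  refine Finset.sum_congr rfl fun k _ => Finset.sum_congr rfl fun l _ => ?_
  rw [Rmat_symm, smul_comm]

/-- The quadratic relation of the R-matrix. -/
theorem Rop_Rop (hq : 0 < q) (f : Fin N → Fin N → E) (i j : Fin N) :
    Rop q (Rop q f) i j = f i j + (q - q⁻¹) • Rop q f i j
      - ((q - q⁻¹) * (q * (q ^ N)⁻¹)) • Cmat N q i j • Ctr q f := by
  induction N using Nat.twoStepInduction with
  | zero => exact i.elim0
  | one =>
    obtain rfl := Subsingleton.elim i 0
    obtain rfl := Subsingleton.elim j 0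
    simp [Ctr_fin_one, Rop_fin_one, mul_inv_cancel₀ hq.ne', Cmat, rho]
  | more N ih _ =>
    obtain ⟨s, hs, h1, h2, h3⟩ := exists_sqrt_pow hq N
    have h4 : (q ^ (N + 2))⁻¹ = s ^ 2 * (q ^ 2)⁻¹ := by rw [pow_add, mul_inv, h1]
    have ht := mul_Ctr_Cmat hq N
    have e2 : q ^ N = (s ^ 2)⁻¹ := by rw [← h1, inv_inv]
    simp only [e2] at ht
    have hC := fun f : Fin N → Fin N → E => Ctr_Rop hq f
    rcases Fin.eq_zero_or_mid_or_last i with rfl | ⟨u, rfl⟩ | rfl <;>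
    rcases Fin.eq_zero_or_mid_or_last j with rfl | ⟨v, rfl⟩ | rfl
    all_goals simp only [Rop_zero_zero, Rop_zero_mid, Rop_zero_last, Rop_mid_zero, Rop_mid_mid,
      Rop_mid_last, Rop_last_zero, Rop_last_mid, Rop_last_last, Ctr_succ, Rop_sub, Rop_smul,
      Rop_Cmat hq, Ctr_sub, Ctr_smul, Ctr_Cmat_smul, ih, hC, h1, h2, h3, h4, Cmat_zero_zero,
      Cmat_zero_mid, Cmat_zero_last, Cmat_mid_zero, Cmat_mid_mid, Cmat_mid_last, Cmat_last_zero,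
      Cmat_last_mid, Cmat_last_last, zero_smul, smul_zero, sub_zero]
    all_goals have hq0 : q ≠ 0 := hq.ne'
    all_goals generalize Ctr q (fun v w : Fin N => Cmat N q v w) = t at ht
    all_goals match_scalars
    all_goals field_simp at ht ⊢
    all_goals first | ring1 | linear_combination (q ^ 2 - 1) * ht

end Structure

/-! ### The inverse R-matrix and the braid relation. -/

section Structure

variable {N : ℕ} {q : ℝ} {E : Type*} [AddCommGroup E] [Module ℝ E]

/-- The quadratic relation, with its K-term cancelled by the eigenvalue of the metric. -/
theorem Sop_Rop (hq : 0 < q) (f : Fin N → Fin N → E) (i j : Fin N) :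
    Sop q (Rop q f) i j = f i j := by
  rw [Sop_eq, Rop_Rop hq, Ctr_Rop hq]
  module

theorem Rop_Sop (hq : 0 < q) (f : Fin N → Fin N → E) (i j : Fin N) :
    Rop q (Sop q f) i j = f i j := by
  have : Sop q f = fun i j =>
    Rop q f i j - (q - q⁻¹) • f i j + (q - q⁻¹) • Cmat N q i j • Ctr q f := by
    funext i j; rw [Sop_eq, mul_smul]
  rw [this]
  simp only [Rop_add, Rop_sub, Rop_smul, Rop_Cmat hq]
  rw [show Rop q (fun a b => Rop q f a b) i j = _ from Rop_Rop hq f i j]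
  module

theorem Ctr_Sop (hq : 0 < q) (f : Fin N → Fin N → E) :
    Ctr q (Sop q f) = (q⁻¹ * q ^ N) • Ctr q f := by
  have h := Ctr_Rop hq (Sop q f)
  rw [show Rop q (Sop q f) = f by funext i j; exact Rop_Sop hq f i j] at h
  rw [h, smul_smul]
  have := hq.ne'
  have e : q⁻¹ * q ^ N * (q * (q ^ N)⁻¹) = 1 := by field_simp
  rw [e, one_smul]

/-- The same crossing symmetry as in `Rmat_slide`, with the metric inserted as a tensor rather than
contracted. -/
theorem Rop_Cmat_slide (hq : 0 < q) (h : Fin N → E) (u v w : Fin N) :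
    Rop q (fun a b => Cmat N q b w • h a) u v = Sop q (fun a b => Cmat N q u a • h b) v w := by
  have e1 : ∀ a, ∑ b, Rmat N q a b u v • Cmat N q b w • h a =
      Rmat N q a w.rev u v • q ^ rho N w • h a := by
    intro a
    rw [Finset.sum_eq_single w.rev]
    · simp [Cmat, rho_rev]
    · intro b _ hb; simp [Cmat, hb]
    · simp
  have e2 : ∑ a, ∑ b, RmatInv N q a b v w • Cmat N q u a • h b =
      ∑ b, RmatInv N q u.rev b v w • q ^ (-rho N u) • h b := by
    rw [Finset.sum_eq_single u.rev]
    · simp [Cmat]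
    · intro b _ hb; simp [Cmat_apply, hb]
    · simp
  unfold Rop Sop
  rw [e2, Finset.sum_congr rfl fun a _ => e1 a]
  refine Finset.sum_congr rfl fun a _ => ?_
  have h1 := Rmat_slide hq u.rev a w.rev v
  simp only [rho_rev, neg_neg, Fin.rev_rev] at h1
  rw [smul_smul, smul_smul]
  congr 1
  have h2 : q ^ rho N u * q ^ (-rho N u) = 1 := by
    rw [← Real.rpow_add hq, add_neg_cancel, Real.rpow_zero]
  have h3 : q ^ rho N w * q ^ (-rho N w) = 1 := by
    rw [← Real.rpow_add hq, add_neg_cancel, Real.rpow_zero]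
  linear_combination (q ^ rho N w * q ^ (-rho N u)) * h1 - (Rmat N q a w.rev u v * q ^ rho N w) * h2
    + (RmatInv N q u.rev a v w * q ^ (-rho N u)) * h3

theorem Rop_Cmat_slide' (hq : 0 < q) (h : Fin N → E) (u v w : Fin N) :
    Rop q (fun a b => Cmat N q u a • h b) v w = Sop q (fun a b => Cmat N q b w • h a) u v := by
  have h1 := Rop_Cmat_slide hq h u v w
  rw [Sop_eq, Ctr_Cmat_right hq] at h1
  rw [Sop_eq, Ctr_Cmat_left hq, h1]
  module

/-- The braid relation. -/
theorem Rop_braid (hq : 0 < q) (f : Fin N → Fin N → Fin N → E) (i j k : Fin N) :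
    Rop q (fun a b => Rop q (fun c d => Rop q (fun g h => f g h d) a c) b k) i j =
    Rop q (fun a b => Rop q (fun c d => Rop q (fun g h => f c g h) d b) i a) j k := by
  induction N using Nat.twoStepInduction with
  | zero => exact i.elim0
  | one =>
    obtain rfl := Subsingleton.elim i 0
    obtain rfl := Subsingleton.elim j 0
    obtain rfl := Subsingleton.elim k 0
    simp [Rop_fin_one]
  | more N ih _ =>
    obtain ⟨s, hs, h1, h2, -⟩ := exists_sqrt_pow hq N
    have e2 : q ^ N = (s ^ 2)⁻¹ := by rw [← h1, inv_inv]
    have ht := mul_Ctr_Cmat hq N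
    simp only [e2] at ht
    have hC := fun f : Fin N → Fin N → E => Ctr_Rop hq f
    have hq0 : q ≠ 0 := hq.ne'
    -- Each index is first, middle or last. The induction hypothesis handles three middle strands;
    -- two middle strands need only the quadratic relation, the eigenvalue and the trace.
    rcases Fin.eq_zero_or_mid_or_last i with rfl | ⟨u, rfl⟩ | rfl <;>
    rcases Fin.eq_zero_or_mid_or_last j with rfl | ⟨v, rfl⟩ | rfl <;>
    rcases Fin.eq_zero_or_mid_or_last k with rfl | ⟨w, rfl⟩ | rfl
    all_goals simp only [Rop_zero_zero, Rop_zero_mid, Rop_zero_last, Rop_mid_zero, Rop_mid_mid,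
      Rop_mid_last, Rop_last_zero, Rop_last_mid, Rop_last_last, Rop_add, Rop_sub, Rop_smul,
      Rop_Cmat hq, Ctr_add, Ctr_sub, Ctr_smul, Ctr_Cmat_smul, ih, hC, Rop_Rop hq, h1, h2]
    all_goals generalize Ctr q (fun v w : Fin N => Cmat N q v w) = t at ht
    all_goals try module
    all_goals try (match_scalars <;> field_simp at ht ⊢ <;>
      first | ring1 | linear_combination (q ^ 2 - 1) * ht
            | linear_combination (q ^ 2 - 1) ^ 2 * ht
            | linear_combination (-(q ^ 2 - 1)) * ht
            | linear_combination (-(q ^ 2 - 1) ^ 2) * ht)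
    -- What remains involves R̂ acting across a metric on neighbouring strands, so strands are moved
    -- through the metric before coefficients are compared.
    all_goals try simp only [Rop_Cmat_slide hq, Rop_Cmat_slide' hq, Ctr_Cmat_left hq, Ctr_Cmat_right hq]
    · rw [Ctr_Rop_slide hq (fun a b c => f a.castSucc.succ b.castSucc.succ c.castSucc.succ)]
      simp only [Sop_eq, Ctr_add, Ctr_sub, Ctr_smul, mul_smul]
      rw [Ctr_Cmat_right hq (fun n => Ctr q fun k m => f k.castSucc.succ m.castSucc.succ
        n.castSucc.succ)]
      match_scalars <;> field_simp <;> ring1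
    · rw [Ctr_Rop_slide hq (fun a b c => Rop q (fun d e => f d.castSucc.succ e.castSucc.succ
        c.castSucc.succ) a b)]
      rw [show Ctr q (fun a b => Sop q (fun a b => Cmat N q b w • f 0 (Fin.last (N + 1))
        a.castSucc.succ) a b) = _ from Ctr_Sop hq _, Ctr_Cmat_left hq, e2]
      simp only [Sop_Rop hq]
      match_scalars <;> field_simp <;> ring1
    · rw [← Ctr_Sop_slide hq (fun a b c => Rop q (fun d e => f a.castSucc.succ d.castSucc.succ
        e.castSucc.succ) b c)]
      rw [show Ctr q (fun a b => Sop q (fun a b => Cmat N q u a • f b.castSucc.succ 0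
        (Fin.last (N + 1))) a b) = _ from Ctr_Sop hq _, Ctr_Cmat_right hq, e2]
      simp only [Sop_Rop hq]
      match_scalars <;> field_simp <;> ring1
    · simp only [Rop_Sop hq]
      rw [Sop_eq _ (fun a b => Cmat N q u a • f 0 b.castSucc.succ (Fin.last (N + 1))),
        Ctr_Cmat_right hq, Rop_Cmat_slide' hq]
      module

end Structure

/-! ### Transfer of the R-matrix identities to vector spaces over 𝕜. -/

section Coefficients

variable (𝕜 : Type*) [RCLike 𝕜] {N : ℕ} (q : ℝ)
variable {E : Type*} [AddCommGroup E] [Module 𝕜 E] {E' : Type*} [AddCommGroup E'] [Module 𝕜 E']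

/-- The operator of the R-matrix on families with two indices in a vector space over `𝕜`. -/
def kRop (f : Fin N → Fin N → E) (i j : Fin N) : E := ∑ k, ∑ l, (Rmat N q k l i j : 𝕜) • f k l

/-- The operator of the inverse R-matrix on families with two indices in a vector space
over `𝕜`. -/
def kSop (f : Fin N → Fin N → E) (i j : Fin N) : E :=
  ∑ k, ∑ l, (RmatInv N q k l i j : 𝕜) • f k l

/-- The contraction by the metric of a family with two indices in a vector space over `𝕜`. -/
def kCtr (f : Fin N → Fin N → E) : E := ∑ k, ∑ l, (Cmat N q k l : 𝕜) • f k l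

variable {𝕜 q}

theorem map_kRop (g : E →ₗ[𝕜] E') (f : Fin N → Fin N → E) (i j : Fin N) :
    g (kRop 𝕜 q f i j) = kRop 𝕜 q (fun a b => g (f a b)) i j := by
  simp [kRop]

theorem map_kSop (g : E →ₗ[𝕜] E') (f : Fin N → Fin N → E) (i j : Fin N) :
    g (kSop 𝕜 q f i j) = kSop 𝕜 q (fun a b => g (f a b)) i j := by
  simp [kSop]

theorem map_kCtr (g : E →ₗ[𝕜] E') (f : Fin N → Fin N → E) :
    g (kCtr 𝕜 q f) = kCtr 𝕜 q (fun a b => g (f a b)) := by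
  simp [kCtr]

section Smul

variable {S : Type*} [Monoid S] [DistribMulAction S E] [SMulCommClass S 𝕜 E]

theorem smul_kRop (s : S) (f : Fin N → Fin N → E) (i j : Fin N) :
    s • kRop 𝕜 q f i j = kRop 𝕜 q (fun a b => s • f a b) i j :=
  map_kRop (DistribSMul.toLinearMap 𝕜 E s) f i j

theorem smul_kSop (s : S) (f : Fin N → Fin N → E) (i j : Fin N) :
    s • kSop 𝕜 q f i j = kSop 𝕜 q (fun a b => s • f a b) i j :=
  map_kSop (DistribSMul.toLinearMap 𝕜 E s) f i j

theorem smul_kCtr (s : S) (f : Fin N → Fin N → E) :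
    s • kCtr 𝕜 q f = kCtr 𝕜 q (fun a b => s • f a b) :=
  map_kCtr (DistribSMul.toLinearMap 𝕜 E s) f

end Smul

theorem kRop_add (f g : Fin N → Fin N → E) (i j : Fin N) :
    kRop 𝕜 q (fun a b => f a b + g a b) i j = kRop 𝕜 q f i j + kRop 𝕜 q g i j := by
  simp [kRop, Finset.sum_add_distrib]

theorem kSop_add (f g : Fin N → Fin N → E) (i j : Fin N) :
    kSop 𝕜 q (fun a b => f a b + g a b) i j = kSop 𝕜 q f i j + kSop 𝕜 q g i j := by
  simp [kSop, Finset.sum_add_distrib]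

theorem kCtr_add (f g : Fin N → Fin N → E) :
    kCtr 𝕜 q (fun a b => f a b + g a b) = kCtr 𝕜 q f + kCtr 𝕜 q g := by
  simp [kCtr, Finset.sum_add_distrib]

theorem kSop_eq (f : Fin N → Fin N → E) (i j : Fin N) : kSop 𝕜 q f i j =
    kRop 𝕜 q f i j - ((q - q⁻¹ : ℝ) : 𝕜) • f i j
      + ((q - q⁻¹ : ℝ) : 𝕜) • (Cmat N q i j : 𝕜) • kCtr 𝕜 q f := by
  -- For this real structure r • v is (r : 𝕜) • v by definition, so real identities transfer
  -- verbatim; the same device serves below.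
  let _ : Module ℝ E := Module.compHom E (algebraMap ℝ 𝕜)
  have := Sop_eq q f i j
  rw [mul_smul] at this
  exact this

theorem kSop_kRop (hq : 0 < q) (f : Fin N → Fin N → E) (i j : Fin N) :
    kSop 𝕜 q (kRop 𝕜 q f) i j = f i j :=
  let _ : Module ℝ E := Module.compHom E (algebraMap ℝ 𝕜)
  Sop_Rop hq f i j

theorem kRop_kSop (hq : 0 < q) (f : Fin N → Fin N → E) (i j : Fin N) :
    kRop 𝕜 q (kSop 𝕜 q f) i j = f i j :=
  let _ : Module ℝ E := Module.compHom E (algebraMap ℝ 𝕜)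
  Rop_Sop hq f i j

theorem kCtr_kSop (hq : 0 < q) (f : Fin N → Fin N → E) :
    kCtr 𝕜 q (kSop 𝕜 q f) = ((q⁻¹ * q ^ N : ℝ) : 𝕜) • kCtr 𝕜 q f :=
  let _ : Module ℝ E := Module.compHom E (algebraMap ℝ 𝕜)
  Ctr_Sop hq f

theorem kCtr_kRop_slide (hq : 0 < q) (f : Fin N → Fin N → Fin N → E) (j : Fin N) :
    kCtr 𝕜 q (fun k l => kRop 𝕜 q (fun m n => f k m n) l j) =
      kCtr 𝕜 q (fun l n => kSop 𝕜 q (fun k m => f k m n) j l) :=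
  let _ : Module ℝ E := Module.compHom E (algebraMap ℝ 𝕜)
  Ctr_Rop_slide hq f j

theorem kCtr_kSop_slide (hq : 0 < q) (f : Fin N → Fin N → Fin N → E) (j : Fin N) :
    kCtr 𝕜 q (fun k l => kSop 𝕜 q (fun m n => f k m n) l j) =
      kCtr 𝕜 q (fun l n => kRop 𝕜 q (fun k m => f k m n) j l) :=
  let _ : Module ℝ E := Module.compHom E (algebraMap ℝ 𝕜)
  Ctr_Sop_slide hq f j

theorem kCtr_Cmat_left (hq : 0 < q) (f : Fin N → E) (j : Fin N) :
    kCtr 𝕜 q (fun k l => (Cmat N q l j : 𝕜) • f k) = f j :=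
  let _ : Module ℝ E := Module.compHom E (algebraMap ℝ 𝕜)
  Ctr_Cmat_left hq f j

theorem kCtr_Cmat_right (hq : 0 < q) (f : Fin N → E) (j : Fin N) :
    kCtr 𝕜 q (fun l n => (Cmat N q j l : 𝕜) • f n) = f j :=
  let _ : Module ℝ E := Module.compHom E (algebraMap ℝ 𝕜)
  Ctr_Cmat_right hq f j

theorem kRop_kRop_Cmat (hq : 0 < q) (h : Fin N → E) (a i j : Fin N) :
    kRop 𝕜 q (fun m n => kRop 𝕜 q (fun p c => (Cmat N q m p : 𝕜) • h c) n j) a i =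
      (Cmat N q i j : 𝕜) • h a := by
  let _ : Module ℝ E := Module.compHom E (algebraMap ℝ 𝕜)
  have h1 : Rop q (fun m n => Rop q (fun p c => Cmat N q m p • h c) n j) a i =
      Cmat N q i j • h a := by
    simp only [Rop_Cmat_slide' hq, Rop_Sop hq]
  exact h1

theorem kRop_braid (hq : 0 < q) (f : Fin N → Fin N → Fin N → E) (i j k : Fin N) :
    kRop 𝕜 q (fun a b => kRop 𝕜 q (fun c d => kRop 𝕜 q (fun g h => f g h d) a c) b k) i j =
    kRop 𝕜 q (fun a b => kRop 𝕜 q (fun c d => kRop 𝕜 q (fun g h => f c g h) d b) i a) j k :=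
  let _ : Module ℝ E := Module.compHom E (algebraMap ℝ 𝕜)
  Rop_braid hq f i j k

/-- The braid relation applied to R̂⁻¹f, then multiplied by R̂⁻¹. This form lets R̂⁻¹ pass through
two crossings. -/
theorem kSop_braid_right (hq : 0 < q) (f : Fin N → Fin N → Fin N → E) (i j k : Fin N) :
    kSop 𝕜 q (fun a b => kRop 𝕜 q (fun c d => kRop 𝕜 q (fun g h => f c g h) d b) i a) j k =
    kRop 𝕜 q (fun a b => kRop 𝕜 q (fun c d => kSop 𝕜 q (fun g h => f g h d) a c) b k) i j := by
  have h := fun j k => kRop_braid (𝕜 := 𝕜) hq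
    (fun a b c => kSop 𝕜 q (fun g h => f g h c) a b) i j k
  simp only [kRop_kSop hq] at h
  simp only [h, kSop_kRop hq]

theorem kSop_braid_left (hq : 0 < q) (f : Fin N → Fin N → Fin N → E) (i j k : Fin N) :
    kSop 𝕜 q (fun a b => kRop 𝕜 q (fun c d => kRop 𝕜 q (fun g h => f g h d) a c) b k) i j =
    kRop 𝕜 q (fun a b => kRop 𝕜 q (fun c d => kSop 𝕜 q (fun g h => f c g h) d b) i a) j k := by
  have h := fun i j => kRop_braid (𝕜 := 𝕜) hq
    (fun a b c => kSop 𝕜 q (fun g h => f a g h) b c) i j k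
  simp only [kRop_kSop hq] at h
  simp only [← h, kSop_kRop hq]

end Coefficients

/-! ### The right action of X on the free left module. -/

section FreeBimodule

variable (𝕜 : Type*) [RCLike 𝕜] (N : ℕ) (q : ℝ)

/-- The scalar `κ` in the relations of the quantum sphere. -/
def kap : ℝ := (q ^ ((N : ℤ) - 1) - q ^ ((N : ℤ) - 3)) / (1 + q ^ ((N : ℤ) - 2))

variable {𝕜 N q}

theorem kCtr_qx_mul_qx : kCtr 𝕜 q (fun k l => qx 𝕜 N q k * qx 𝕜 N q l) = 1 := by
  have h := RingQuot.mkAlgHom_rel 𝕜 (SphereRel.radius (𝕜 := 𝕜) (N := N) (q := q))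
  simp only [map_sum, map_smul, map_mul, map_one] at h
  exact h

theorem kSop_qx_mul_qx (i j : Fin N) :
    kSop 𝕜 q (fun k l => qx 𝕜 N q k * qx 𝕜 N q l) i j =
      ((q⁻¹ : ℝ) : 𝕜) • (qx 𝕜 N q i * qx 𝕜 N q j)
        + (kap N q : 𝕜) • (Cmat N q i j : 𝕜) • (1 : QSphere 𝕜 N q) := by
  have h := RingQuot.mkAlgHom_rel 𝕜 (SphereRel.comm (𝕜 := 𝕜) (N := N) (q := q) i j)
  simp only [map_sum, map_smul, map_mul, map_add] at h
  refine Eq.trans h ?_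
  rw [← kCtr_qx_mul_qx]
  unfold kCtr
  simp only [Finset.smul_sum, smul_smul, Kmat, RCLike.ofReal_mul, kap]
  rfl

theorem QSphere.induction {p : QSphere 𝕜 N q → Prop} (h1 : p 1)
    (hx : ∀ i, p (qx 𝕜 N q i)) (hs : ∀ (c : 𝕜) (a), p a → p (c • a))
    (ha : ∀ a b, p a → p b → p (a + b)) (hm : ∀ a b, p a → p b → p (a * b)) (a) : p a := by
  obtain ⟨a, rfl⟩ := RingQuot.mkAlgHom_surjective 𝕜 (SphereRel 𝕜 N q) a
  induction a using FreeAlgebra.induction with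
  | grade0 r =>
    rw [Algebra.algebraMap_eq_smul_one, map_smul, map_one]
    exact hs r _ h1
  | grade1 i => exact hx i
  | mul a b ha hb => rw [map_mul]; exact hm _ _ ha hb
  | add a b h h' => rw [map_add]; exact ha _ _ h h'

variable (𝕜 N q)

/-- The basis of the free left module. -/
abbrev unitVec (i : Fin N) : Fin N → QSphere 𝕜 N q := Pi.single i 1

/-- Right multiplication by `x_j` on the free left module with basis `e_1, …, e_N`:
`e_i x_j = R̂^{kl}_{ij} x_k e_l`. -/
def rightGen (j : Fin N) : Module.End (QSphere 𝕜 N q) (Fin N → QSphere 𝕜 N q) :=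
  (Pi.basisFun (QSphere 𝕜 N q) (Fin N)).constr 𝕜 fun i =>
    kRop 𝕜 q (fun k l => qx 𝕜 N q k • unitVec 𝕜 N q l) i j

variable {𝕜 N q}

theorem rightGen_single (i j : Fin N) : rightGen 𝕜 N q j (unitVec 𝕜 N q i) =
    kRop 𝕜 q (fun k l => qx 𝕜 N q k • unitVec 𝕜 N q l) i j := by
  have := (Pi.basisFun (QSphere 𝕜 N q) (Fin N)).constr_basis 𝕜 (fun i =>
    kRop 𝕜 q (fun k l => qx 𝕜 N q k • unitVec 𝕜 N q l) i j) i
  rwa [Pi.basisFun_apply] at this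

theorem map_left_kRop {E E' : Type*} [AddCommGroup E] [Module 𝕜 E] [Module (QSphere 𝕜 N q) E]
    [IsScalarTower 𝕜 (QSphere 𝕜 N q) E] [AddCommGroup E'] [Module 𝕜 E']
    [Module (QSphere 𝕜 N q) E'] [IsScalarTower 𝕜 (QSphere 𝕜 N q) E']
    (g : E →ₗ[QSphere 𝕜 N q] E') (f : Fin N → Fin N → E) (i j : Fin N) :
    g (kRop 𝕜 q f i j) = kRop 𝕜 q (fun a b => g (f a b)) i j :=
  map_kRop (g.restrictScalars 𝕜) f i j

theorem map_left_kCtr {E E' : Type*} [AddCommGroup E] [Module 𝕜 E] [Module (QSphere 𝕜 N q) E]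
    [IsScalarTower 𝕜 (QSphere 𝕜 N q) E] [AddCommGroup E'] [Module 𝕜 E']
    [Module (QSphere 𝕜 N q) E'] [IsScalarTower 𝕜 (QSphere 𝕜 N q) E']
    (g : E →ₗ[QSphere 𝕜 N q] E') (f : Fin N → Fin N → E) :
    g (kCtr 𝕜 q f) = kCtr 𝕜 q (fun a b => g (f a b)) :=
  map_kCtr (g.restrictScalars 𝕜) f

theorem rightGen_rightGen (a k l : Fin N) :
    rightGen 𝕜 N q l (rightGen 𝕜 N q k (unitVec 𝕜 N q a)) =
      kRop 𝕜 q (fun m n => kRop 𝕜 q (fun p c => (qx 𝕜 N q m * qx 𝕜 N q p) • unitVec 𝕜 N q c) n l)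
        a k := by
  rw [rightGen_single, map_left_kRop]
  simp only [map_smul, rightGen_single, smul_kRop, smul_smul]

theorem kSop_qx_mul_qx_smul {E : Type*} [AddCommGroup E] [Module 𝕜 E] [Module (QSphere 𝕜 N q) E]
    [IsScalarTower 𝕜 (QSphere 𝕜 N q) E] (v : E) (i j : Fin N) :
    kSop 𝕜 q (fun k l => (qx 𝕜 N q k * qx 𝕜 N q l) • v) i j =
      ((q⁻¹ : ℝ) : 𝕜) • (qx 𝕜 N q i * qx 𝕜 N q j) • v + (kap N q : 𝕜) • (Cmat N q i j : 𝕜) • v := by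
  have h := map_kSop (q := q) ((LinearMap.toSpanSingleton (QSphere 𝕜 N q) E v).restrictScalars 𝕜)
    (fun k l => qx 𝕜 N q k * qx 𝕜 N q l) i j
  simp only [LinearMap.coe_restrictScalars, LinearMap.toSpanSingleton_apply] at h
  rw [← h, kSop_qx_mul_qx]
  simp only [add_smul, smul_assoc, one_smul]

/-- The braid relation carries R̂⁻¹ to the factors x_m x_p, where the relation of X applies; the
resulting metric term passes through both crossings unchanged by `kRop_kRop_Cmat`. -/
theorem kSop_rightGen_rightGen (hq : 0 < q) (a i j : Fin N) :
    kSop 𝕜 q (fun k l => rightGen 𝕜 N q l (rightGen 𝕜 N q k (unitVec 𝕜 N q a))) i j =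
      ((q⁻¹ : ℝ) : 𝕜) • rightGen 𝕜 N q j (rightGen 𝕜 N q i (unitVec 𝕜 N q a))
      + (kap N q : 𝕜) • (Cmat N q i j : 𝕜) • unitVec 𝕜 N q a := by
  simp only [rightGen_rightGen, kSop_braid_right hq (fun m p c =>
    (qx 𝕜 N q m * qx 𝕜 N q p) • unitVec 𝕜 N q c),
    kSop_qx_mul_qx_smul, kRop_add, ← smul_kRop, kRop_kRop_Cmat hq]

/-- Sliding a strand through the metric turns one of the two R-matrices into its inverse; they
cancel and leave C^{kl} x_k x_l = 1. -/
theorem kCtr_rightGen_rightGen (hq : 0 < q) (a : Fin N) :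
    kCtr 𝕜 q (fun k l => rightGen 𝕜 N q l (rightGen 𝕜 N q k (unitVec 𝕜 N q a))) =
      unitVec 𝕜 N q a := by
  simp only [rightGen_rightGen]
  rw [← kCtr_kSop_slide hq (fun m n l => kRop 𝕜 q (fun p c =>
    (qx 𝕜 N q m * qx 𝕜 N q p) • unitVec 𝕜 N q c) n l)]
  simp only [kSop_kRop hq]
  have h := map_left_kCtr (LinearMap.toSpanSingleton (QSphere 𝕜 N q) _
    (unitVec 𝕜 N q a)) (fun k l => qx 𝕜 N q k * qx 𝕜 N q l)
  simp only [LinearMap.toSpanSingleton_apply] at h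
  rw [← h, kCtr_qx_mul_qx, one_smul]

/-- The right action of the quantum sphere on the free left module. -/
def rightAct (hq : 0 < q) : QSphere 𝕜 N q →ₐ[𝕜]
    (Module.End (QSphere 𝕜 N q) (Fin N → QSphere 𝕜 N q))ᵐᵒᵖ :=
  RingQuot.liftAlgHom 𝕜 ⟨FreeAlgebra.lift 𝕜 fun j => op (rightGen 𝕜 N q j), by
    intro a b h
    have key : ∀ c : Fin N → Fin N → 𝕜, ∀ a,
        (∑ k, ∑ l, c k l • (op (rightGen 𝕜 N q k) * op (rightGen 𝕜 N q l))).unop (unitVec 𝕜 N q a) =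
          ∑ k, ∑ l, c k l • rightGen 𝕜 N q l (rightGen 𝕜 N q k (unitVec 𝕜 N q a)) := by
      intro c a
      simp only [Finset.unop_sum, MulOpposite.unop_smul, MulOpposite.unop_mul,
        MulOpposite.unop_op, LinearMap.sum_apply, LinearMap.smul_apply, Module.End.mul_apply]
    have h0 := fun a i j => kSop_rightGen_rightGen (𝕜 := 𝕜) (N := N) hq a i j
    have h1 := fun a => kCtr_rightGen_rightGen (𝕜 := 𝕜) (N := N) hq a
    apply MulOpposite.unop_injective
    refine (Pi.basisFun (QSphere 𝕜 N q) (Fin N)).ext fun a => ?_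
    rw [Pi.basisFun_apply]
    cases h with
    | comm i j =>
      simp only [map_sum, map_smul, map_mul, map_add, FreeAlgebra.lift_ι_apply,
        MulOpposite.unop_add, LinearMap.add_apply, MulOpposite.unop_smul, LinearMap.smul_apply, key]
      refine (h0 a i j).trans ?_
      congr 1
      -- The defining relation has K^{kl}_{ij} x_k x_l in place of a constant, so the identity is
      -- rewritten as the action of C^{kl} x_k x_l.
      nth_rw 1 [← h1 a]
      unfold kCtr
      simp only [Finset.smul_sum, smul_smul, Kmat, RCLike.ofReal_mul, kap]
    | radius =>
      simp only [map_sum, map_smul, map_mul, map_one, FreeAlgebra.lift_ι_apply, key]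
      exact h1 a⟩

theorem rightAct_qx (hq : 0 < q) (j : Fin N) :
    rightAct (𝕜 := 𝕜) hq (qx 𝕜 N q j) = op (rightGen 𝕜 N q j) := by
  refine (RingQuot.liftAlgHom_mkAlgHom_apply 𝕜 _ _ _).trans ?_
  exact FreeAlgebra.lift_ι_apply _ _

end FreeBimodule

/-! ### The inner derivation by ω and its coefficients. -/

section Coordinates

variable {𝕜 : Type*} [RCLike 𝕜] {N : ℕ} {q : ℝ}

theorem zpow_facts (hq : 0 < q) (hN : 2 ≤ N) (hq1 : q ≠ 1) : ∃ P : ℝ, 0 < P ∧ q * P ≠ 1 ∧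
    q ^ ((N : ℤ) - 2) = P ∧ q ^ ((N : ℤ) - 1) = q * P ∧ q ^ ((N : ℤ) - 3) = P * q⁻¹ ∧
    q ^ (N : ℤ) = q ^ 2 * P := by
  have h0 := hq.ne'
  have e1 : q ^ ((N : ℤ) - 1) = q * q ^ ((N : ℤ) - 2) := by
    rw [← zpow_one_add₀ h0]; congr 1; ring
  refine ⟨q ^ ((N : ℤ) - 2), zpow_pos hq _, ?_, rfl, e1, ?_, ?_⟩
  · rw [← e1, ← Nat.cast_one, ← Nat.cast_sub (by omega), zpow_natCast]
    intro h
    exact hq1 ((pow_eq_one_iff_of_nonneg hq.le (by omega)).1 h)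
  · rw [← zpow_sub_one₀ h0]; congr 1; ring
  · rw [← zpow_natCast q 2, ← zpow_add₀ h0]; congr 1; push_cast; ring

theorem sq_ne_one (hq : 0 < q) (hq1 : q ≠ 1) : q ^ 2 - 1 ≠ 0 := by
  intro h
  exact hq1 ((pow_eq_one_iff_of_nonneg hq.le two_ne_zero).1 (by linarith))

theorem kap_ne_zero (hq : 0 < q) (hN : 2 ≤ N) (hq1 : q ≠ 1) : kap N q ≠ 0 := by
  obtain ⟨P, hP, -, h2, h1, h3, -⟩ := zpow_facts hq hN hq1
  rw [kap, h1, h2, h3]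
  have h4 : 1 + P ≠ 0 := by positivity
  have h5 : q * P - P * q⁻¹ = P * q⁻¹ * (q ^ 2 - 1) := by field_simp
  rw [h5]
  have := sq_ne_one hq hq1
  positivity

variable (𝕜 N q) in
/-- The one-form `C^{kl} x_k e_l` in the free bimodule. -/
def freeOmega : Fin N → QSphere 𝕜 N q := kCtr 𝕜 q fun k l => qx 𝕜 N q k • unitVec 𝕜 N q l

/-- After the slide R̂⁻¹ acts on x_k x_m. Since κ ≠ 0, the formula recovers every e_j from
commutators with ω, which makes the differential inner. -/
theorem rightGen_freeOmega (hq : 0 < q) (j : Fin N) : rightGen 𝕜 N q j (freeOmega 𝕜 N q) =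
    ((q⁻¹ : ℝ) : 𝕜) • qx 𝕜 N q j • freeOmega 𝕜 N q + (kap N q : 𝕜) • unitVec 𝕜 N q j := by
  rw [freeOmega, map_left_kCtr]
  simp only [map_smul, rightGen_single, smul_kRop, smul_smul]
  rw [kCtr_kRop_slide hq (fun k m n => (qx 𝕜 N q k * qx 𝕜 N q m) • unitVec 𝕜 N q n)]
  simp only [kSop_qx_mul_qx_smul]
  rw [kCtr_add, ← smul_kCtr, ← smul_kCtr, kCtr_Cmat_right hq]
  simp only [mul_smul, ← smul_kCtr]

theorem kSop_add_smul {E : Type*} [AddCommGroup E] [Module 𝕜 E] [Module (QSphere 𝕜 N q) E]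
    [IsScalarTower 𝕜 (QSphere 𝕜 N q) E] (e : Fin N → E) (w : E) (b : 𝕜) (i j : Fin N) :
    kSop 𝕜 q (fun k l => qx 𝕜 N q k • (e l + b • qx 𝕜 N q l • w)) i j =
      kRop 𝕜 q (fun k l => qx 𝕜 N q k • e l) i j - ((q - q⁻¹ : ℝ) : 𝕜) • qx 𝕜 N q i • e j
      + ((q - q⁻¹ : ℝ) : 𝕜) • (Cmat N q i j : 𝕜) • kCtr 𝕜 q (fun k l => qx 𝕜 N q k • e l)
      + b • (((q⁻¹ : ℝ) : 𝕜) • (qx 𝕜 N q i * qx 𝕜 N q j) • w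
        + (kap N q : 𝕜) • (Cmat N q i j : 𝕜) • w) := by
  have : SMulCommClass (QSphere 𝕜 N q) 𝕜 E := IsScalarTower.to_smulCommClass'
  simp only [smul_add, smul_comm (qx 𝕜 N q _) b, smul_smul (qx 𝕜 N q _) (qx 𝕜 N q _)]
  rw [kSop_add, ← smul_kSop, kSop_qx_mul_qx_smul, kSop_eq, smul_add]

theorem kCtr_add_smul {E : Type*} [AddCommGroup E] [Module 𝕜 E] [Module (QSphere 𝕜 N q) E]
    [IsScalarTower 𝕜 (QSphere 𝕜 N q) E] (e : Fin N → E) (w : E) (b : 𝕜) :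
    kCtr 𝕜 q (fun k l => qx 𝕜 N q k • (e l + b • qx 𝕜 N q l • w)) =
      kCtr 𝕜 q (fun k l => qx 𝕜 N q k • e l) + b • w := by
  have : SMulCommClass (QSphere 𝕜 N q) 𝕜 E := IsScalarTower.to_smulCommClass'
  simp only [smul_add, smul_comm (qx 𝕜 N q _) b, smul_smul (qx 𝕜 N q _) (qx 𝕜 N q _)]
  have h := map_left_kCtr (LinearMap.toSpanSingleton (QSphere 𝕜 N q) E w)
    (fun k l => qx 𝕜 N q k * qx 𝕜 N q l)
  simp only [LinearMap.toSpanSingleton_apply] at h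
  rw [kCtr_add, ← smul_kCtr, ← h, kCtr_qx_mul_qx, one_smul]

/-- The bimodule relations of `Γ₊` for the forms `e_i + β x_i ω` in the free bimodule. -/
theorem rightGen_relation (hq : 0 < q) (b c₁ c₂ : ℝ) (h1 : b * kap N q = q⁻¹ - 1)
    (h2 : c₁ * (1 + b) = 1 - q) (h3 : c₂ * (1 + b) = (1 - q) * b) (i j : Fin N) :
    let x := qx 𝕜 N q
    let w := freeOmega 𝕜 N q
    let D := fun i => unitVec 𝕜 N q i + (b : 𝕜) • x i • w
    rightGen 𝕜 N q j (D i) =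
      kSop 𝕜 q (fun k l => x k • D l) i j + ((q - 1 : ℝ) : 𝕜) • x i • D j
      + (c₁ : 𝕜) • (Cmat N q i j : 𝕜) • kCtr 𝕜 q (fun k l => x k • D l)
      + (c₂ : 𝕜) • (x i * x j) • kCtr 𝕜 q (fun k l => x k • D l) := by
  intro x w D
  have h1' := congrArg (RCLike.ofReal (K := 𝕜)) h1
  have h2' := congrArg (RCLike.ofReal (K := 𝕜)) h2
  have h3' := congrArg (RCLike.ofReal (K := 𝕜)) h3
  -- The image of H is (1 + b)ω, which is why `h2` and `h3` carry the factor 1 + b.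
  have e1 : kCtr 𝕜 q (fun k l => x k • D l) = w + (b : 𝕜) • w := kCtr_add_smul _ w (b : 𝕜)
  have e2 := kSop_add_smul (q := q) (fun l => unitVec 𝕜 N q l) w (b : 𝕜) i j
  have e3 : rightGen 𝕜 N q j (D i) = kRop 𝕜 q (fun k l => x k • unitVec 𝕜 N q l) i j
      + (b : 𝕜) • x i • (((q⁻¹ : ℝ) : 𝕜) • x j • w + (kap N q : 𝕜) • unitVec 𝕜 N q j) := by
    rw [← rightGen_freeOmega hq, ← rightGen_single]
    simp only [D, map_add, LinearMap.map_smul_of_tower, map_smul]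
    rfl
  have e4 : kCtr 𝕜 q (fun k l => qx 𝕜 N q k • unitVec 𝕜 N q l) = w := rfl
  rw [e4] at e2
  rw [e1, e3, e2]
  push_cast at h1' h2' h3' ⊢
  simp only [D, x, smul_add, smul_comm (qx 𝕜 N q _) (_ : 𝕜), mul_smul]
  generalize qx 𝕜 N q i • qx 𝕜 N q j • w = A
  generalize qx 𝕜 N q i • unitVec 𝕜 N q j = B
  match_scalars
  · ring
  · linear_combination -h3'
  · linear_combination h1'
  · linear_combination (-(Cmat N q i j : 𝕜)) * (h1' + h2')

/-- b is forced by bκ = q⁻¹ − 1. The next two equations match the coefficients of the relations of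
Γ, and the last one cancels the ω-part of the image of γ⁺_i. -/
theorem kap_facts (hq : 0 < q) (hN : 2 ≤ N) (hq1 : q ≠ 1) :
    ∃ b : ℝ, 1 + b ≠ 0 ∧ b * kap N q = q⁻¹ - 1 ∧
      (q ^ (N : ℤ) - q ^ ((N : ℤ) - 2)) / (1 - q ^ ((N : ℤ) - 1)) * (1 + b) = 1 - q ∧
      (1 - q) * (1 + q ^ ((N : ℤ) - 2)) / (1 - q ^ ((N : ℤ) - 1)) * (1 + b) = (1 - q) * b ∧
      -((1 + q ^ ((N : ℤ) - 2)) / (1 - q ^ ((N : ℤ) - 1))) * (1 + b) = -b := by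
  obtain ⟨P, hP, hP1, h2, h1, h3, h4⟩ := zpow_facts hq hN hq1
  have h5 : 1 + q ≠ 0 := by positivity
  have h6 : 1 - q * P ≠ 0 := fun h => hP1 (by linarith)
  have h7 : 1 + P ≠ 0 := by positivity
  have e : 1 + -(1 + P) / (P * (1 + q)) = -(1 - q * P) / (P * (1 + q)) := by
    field_simp; ring
  refine ⟨-(1 + P) / (P * (1 + q)), ?_, ?_, ?_, ?_, ?_⟩
  · rw [e]; exact div_ne_zero (neg_ne_zero.2 h6) (by positivity)
  · rw [kap, h1, h2, h3]; field_simp; ring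
  · rw [e, h1, h2, h4]; field_simp; ring
  · rw [e, h1, h2]; field_simp
  · rw [e, h1, h2]; field_simp; rw [mul_comm P q]; exact div_self h6

/-- Right multiplication on the free bimodule. -/
def rightOp (hq : 0 < q) (x : QSphere 𝕜 N q) :
    Module.End (QSphere 𝕜 N q) (Fin N → QSphere 𝕜 N q) := (rightAct hq x).unop

theorem rightOp_mul (hq : 0 < q) (x y : QSphere 𝕜 N q) (v) :
    rightOp hq (x * y) v = rightOp hq y (rightOp hq x v) := by
  rw [rightOp, map_mul]; rfl

theorem rightOp_add (hq : 0 < q) (x y : QSphere 𝕜 N q) (v) :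
    rightOp hq (x + y) v = rightOp hq x v + rightOp hq y v := by
  rw [rightOp, map_add]; rfl

theorem rightOp_smul (hq : 0 < q) (c : 𝕜) (x : QSphere 𝕜 N q) (v) :
    rightOp hq (c • x) v = c • rightOp hq x v := by
  rw [rightOp, map_smul]; rfl

theorem rightOp_one (hq : 0 < q) (v : Fin N → QSphere 𝕜 N q) : rightOp hq 1 v = v := by
  rw [rightOp, map_one]; rfl

theorem rightOp_qx (hq : 0 < q) (j : Fin N) :
    rightOp hq (qx 𝕜 N q j) = rightGen 𝕜 N q j := by
  rw [rightOp, rightAct_qx]; rfl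

/-- Right multiplication on the free bimodule as a homomorphism of algebras. -/
def rightEnd (hq : 0 < q) :
    (QSphere 𝕜 N q)ᵐᵒᵖ →ₐ[𝕜] Module.End 𝕜 (Fin N → QSphere 𝕜 N q) where
  toFun y := (rightOp hq y.unop).restrictScalars 𝕜
  map_one' := LinearMap.ext fun v => rightOp_one hq v
  map_mul' x y := LinearMap.ext fun v => rightOp_mul hq y.unop x.unop v
  map_zero' := by ext v; simp [rightOp]
  map_add' x y := LinearMap.ext fun v => rightOp_add hq x.unop y.unop v
  commutes' c := LinearMap.ext fun v => by
    rw [Algebra.algebraMap_eq_smul_one, Algebra.algebraMap_eq_smul_one]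
    exact (rightOp_smul hq c 1 v).trans (by rw [rightOp_one]; rfl)

theorem commute_rightEnd (hq : 0 < q) (x : QSphere 𝕜 N q) (y : (QSphere 𝕜 N q)ᵐᵒᵖ) :
    Commute (Algebra.lsmul 𝕜 𝕜 (Fin N → QSphere 𝕜 N q) x) (rightEnd hq y) :=
  LinearMap.ext fun v => ((rightOp hq y.unop).map_smul x v).symm

/-- The action of the enveloping algebra on the free bimodule. -/
def freeAct (hq : 0 < q) :
    Env 𝕜 (QSphere 𝕜 N q) →ₐ[𝕜] Module.End 𝕜 (Fin N → QSphere 𝕜 N q) :=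
  Algebra.TensorProduct.lift (Algebra.lsmul 𝕜 𝕜 (Fin N → QSphere 𝕜 N q)) (rightEnd hq)
    (commute_rightEnd hq)

theorem freeAct_envL (hq : 0 < q) (x : QSphere 𝕜 N q) (v : Fin N → QSphere 𝕜 N q) :
    freeAct hq (envL 𝕜 x) v = x • v :=
  DFunLike.congr_fun (DFunLike.congr_fun (Algebra.TensorProduct.lift_comp_includeLeft
    (Algebra.lsmul 𝕜 𝕜 (Fin N → QSphere 𝕜 N q)) (rightEnd hq) (commute_rightEnd hq)) x) v

theorem freeAct_envR (hq : 0 < q) (x : QSphere 𝕜 N q) (v : Fin N → QSphere 𝕜 N q) :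
    freeAct hq (envR 𝕜 x) v = rightOp hq x v :=
  DFunLike.congr_fun (DFunLike.congr_fun (Algebra.TensorProduct.lift_comp_includeRight
    (Algebra.lsmul 𝕜 𝕜 (Fin N → QSphere 𝕜 N q)) (rightEnd hq) (commute_rightEnd hq)) (op x)) v

end Coordinates

/-! ### The coordinate map on Γ, and left generators of Γ. -/

section FormCoordinates

variable {𝕜 : Type*} [RCLike 𝕜] {N : ℕ} {q : ℝ}

/-- A bimodule map from the calculus `Γ₊` to the free bimodule, whose differential is inner. -/
theorem exists_coord (hq : 0 < q) (hN : 2 ≤ N) (hq1 : q ≠ 1) :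
    ∃ c : Gam 𝕜 N q →ₗ[QSphere 𝕜 N q] (Fin N → QSphere 𝕜 N q),
      (∀ x w, c (op x • w) = rightOp hq x (c w)) ∧
      ∃ b : ℝ, 1 + b ≠ 0 ∧ b * kap N q = q⁻¹ - 1 ∧
        -((1 + q ^ ((N : ℤ) - 2)) / (1 - q ^ ((N : ℤ) - 1))) * (1 + b) = -b ∧
        ∀ i, c (gd 𝕜 N q (qx 𝕜 N q i)) =
          unitVec 𝕜 N q i + (b : 𝕜) • qx 𝕜 N q i • freeOmega 𝕜 N q := by
  obtain ⟨b, hb, h1, h2, h3, h4⟩ := kap_facts hq hN hq1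
  have hk := kap_ne_zero hq hN hq1
  let _ : Module (Env 𝕜 (QSphere 𝕜 N q)) (Fin N → QSphere 𝕜 N q) :=
    Module.compHom _ (freeAct hq).toRingHom
  have hL : ∀ (x : QSphere 𝕜 N q) (v : Fin N → QSphere 𝕜 N q), envL 𝕜 x • v = x • v := freeAct_envL hq
  have hR : ∀ (x : QSphere 𝕜 N q) (v : Fin N → QSphere 𝕜 N q), envR 𝕜 x • v = rightOp hq x v := freeAct_envR hq
  have hT : IsScalarTower 𝕜 (Env 𝕜 (QSphere 𝕜 N q)) (Fin N → QSphere 𝕜 N q) :=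
    IsScalarTower.of_algebraMap_smul fun r v => by
      change freeAct hq (algebraMap _ _ r) v = r • v
      rw [AlgHom.commutes]; rfl
  -- Universal one-forms lie in the enveloping algebra, so they can be applied to κ⁻¹ω; on the
  -- universal differential of x this gives the commutator κ⁻¹(ωx − xω).
  let F : UnivForms 𝕜 (QSphere 𝕜 N q) →ₗ[Env 𝕜 (QSphere 𝕜 N q)] (Fin N → QSphere 𝕜 N q) :=
    (LinearMap.toSpanSingleton (Env 𝕜 (QSphere 𝕜 N q)) _
      ((((kap N q)⁻¹ : ℝ) : 𝕜) • freeOmega 𝕜 N q)).comp (UnivForms 𝕜 (QSphere 𝕜 N q)).subtype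
  have hF : ∀ i, F (univD 𝕜 _ (qx 𝕜 N q i)) =
      unitVec 𝕜 N q i + (b : 𝕜) • qx 𝕜 N q i • freeOmega 𝕜 N q := by
    intro i
    have hk' : (kap N q : 𝕜) ≠ 0 := by exact_mod_cast hk
    have h1' := congrArg (RCLike.ofReal (K := 𝕜)) h1
    have e : F (univD 𝕜 _ (qx 𝕜 N q i)) = (envR 𝕜 (qx 𝕜 N q i) - envL 𝕜 (qx 𝕜 N q i)) •
      ((((kap N q)⁻¹ : ℝ) : 𝕜) • freeOmega 𝕜 N q) := rfl
    rw [e, sub_smul, hL, hR, rightOp_qx, LinearMap.map_smul_of_tower, rightGen_freeOmega hq,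
      smul_comm (qx 𝕜 N q i) (_ : 𝕜)]
    push_cast at h1' ⊢
    generalize qx 𝕜 N q i • freeOmega 𝕜 N q = A
    match_scalars
    · field_simp; linear_combination -h1'
    · field_simp
  have hS : Submodule.span (Env 𝕜 (QSphere 𝕜 N q))
      (Set.range fun p : Fin N × Fin N => gammaRel 𝕜 N q p.1 p.2) ≤ LinearMap.ker F := by
    rw [Submodule.span_le]
    rintro _ ⟨⟨i, j⟩, rfl⟩
    change F (gammaRel 𝕜 N q i j) = 0
    have hFk : ∀ (r : 𝕜) u, F (r • u) = r • F u := fun r u => F.map_smul_of_tower r u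
    have h := rightGen_relation (𝕜 := 𝕜) (N := N) hq b _ _ h1 h2 h3 i j
    rw [gammaRel]
    simp only [map_sub F, map_add F, map_smul F, map_sum F, hFk, hF, hL, hR, rightOp_qx]
    rw [sub_eq_zero]
    refine h.trans ?_
    congr 1
    · congr 1
      congr 1
      unfold kCtr
      simp only [Finset.smul_sum, smul_smul, Kmat, RCLike.ofReal_mul]
    · unfold kCtr
      simp only [Finset.smul_sum, smul_comm (_ * _ : QSphere 𝕜 N q) (_ : 𝕜), smul_smul]
  let Φ : Gam 𝕜 N q →ₗ[Env 𝕜 (QSphere 𝕜 N q)] (Fin N → QSphere 𝕜 N q) :=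
    Submodule.liftQ _ F hS
  refine ⟨{ toFun := Φ, map_add' := map_add Φ, map_smul' := fun x w => ?_ }, fun x w => ?_,
    b, hb, h1, h4, hF⟩
  · exact (map_smul Φ (envL 𝕜 x) w).trans (hL _ _)
  · exact (map_smul Φ (envR 𝕜 x) w).trans (hR _ _)

/-! The left module `Γ₊` is generated by the differentials of the generators. -/

theorem op_smul_mem_span {ι : Type*} {v : ι → Gam 𝕜 N q}
    (hv : ∀ i j, op (qx 𝕜 N q j) • v i ∈ Submodule.span (QSphere 𝕜 N q) (Set.range v))
    (x : QSphere 𝕜 N q) {w : Gam 𝕜 N q}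
    (hw : w ∈ Submodule.span (QSphere 𝕜 N q) (Set.range v)) :
    op x • w ∈ Submodule.span (QSphere 𝕜 N q) (Set.range v) := by
  induction x using QSphere.induction generalizing w with
  | h1 => simpa using hw
  | hx j =>
    induction hw using Submodule.span_induction with
    | mem w h => obtain ⟨i, rfl⟩ := h; exact hv i j
    | zero => rw [smul_zero]; exact zero_mem _
    | add a b _ _ ha hb => rw [smul_add]; exact add_mem ha hb
    | smul a w _ h => rw [← smul_comm]; exact Submodule.smul_mem _ _ h
  | hs c a ha =>
    rw [MulOpposite.op_smul, smul_assoc]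
    exact Submodule.smul_of_tower_mem _ c (ha hw)
  | ha a b ha hb => rw [MulOpposite.op_add, add_smul]; exact add_mem (ha hw) (hb hw)
  | hm a b ha hb => rw [MulOpposite.op_mul, mul_smul]; exact hb (ha hw)

theorem span_gd : Submodule.span (QSphere 𝕜 N q)
    (Set.range fun i => gd 𝕜 N q (qx 𝕜 N q i)) = ⊤ := by
  set L := Submodule.span (QSphere 𝕜 N q) (Set.range fun i => gd 𝕜 N q (qx 𝕜 N q i)) with hL
  have hg : ∀ i, gd 𝕜 N q (qx 𝕜 N q i) ∈ L := fun i => Submodule.subset_span ⟨i, rfl⟩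
  have hop : ∀ x w, w ∈ L → op x • w ∈ L := fun x w hw => by
    refine op_smul_mem_span (fun i j => ?_) x hw
    rw [gd_mul_qx]
    have hk : ∀ (r : 𝕜) w, w ∈ L → r • w ∈ L := fun r w h => Submodule.smul_of_tower_mem _ r h
    have hs : ∀ c : Fin N → Fin N → 𝕜, ∀ y : Fin N → QSphere 𝕜 N q,
        ∑ k, ∑ l, c k l • y k • gd 𝕜 N q (qx 𝕜 N q l) ∈ L := fun c y =>
      sum_mem fun k _ => sum_mem fun l _ => hk _ _ (Submodule.smul_mem _ _ (hg l))
    exact add_mem (add_mem (add_mem (hs _ _) (hk _ _ (Submodule.smul_mem _ _ (hg j))))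
      (hk _ _ (hs _ _))) (hk _ _ (hs _ _))
  have hd : ∀ x, gd 𝕜 N q x ∈ L := fun x => by
    induction x using QSphere.induction with
    | h1 =>
      have h := Forms.d_mul (Set.range fun p : Fin N × Fin N => gammaRel 𝕜 N q p.1 p.2) 1 1
      rw [mul_one, MulOpposite.op_one, one_smul, one_smul] at h
      rw [show gd 𝕜 N q 1 = 0 from left_eq_add.1 h]
      exact zero_mem _
    | hx i => exact hg i
    | hs c a ha => rw [map_smul]; exact Submodule.smul_of_tower_mem _ c ha
    | ha a b ha hb => rw [map_add]; exact add_mem ha hb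
    | hm a b ha hb =>
      rw [Forms.d_mul]
      exact add_mem (hop _ _ ha) (Submodule.smul_mem _ _ hb)
  -- A projection onto the universal one-forms with a ⊗ b ↦ a db; it reduces the claim to forms a
  -- db.
  have hpr : ∀ e : Env 𝕜 (QSphere 𝕜 N q), e - envL 𝕜 (envMul 𝕜 _ e) ∈ UnivForms 𝕜 _ := fun e => by
    change envMul 𝕜 _ _ = 0
    have := envMul_apply 𝕜 (envMul 𝕜 (QSphere 𝕜 N q) e) 1
    rw [mul_one, envR, MulOpposite.op_one, map_one, mul_one] at this
    rw [map_sub, this, sub_self]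
  have hall : ∀ e : Env 𝕜 (QSphere 𝕜 N q), (Forms.mk _ ⟨_, hpr e⟩ : Gam 𝕜 N q) ∈ L := fun e => by
    induction e using Env.induction with
    | h0 =>
      have : (⟨_, hpr 0⟩ : UnivForms 𝕜 (QSphere 𝕜 N q)) = 0 := by ext; simp
      rw [this, map_zero]; exact zero_mem _
    | ht a b =>
      have : (⟨_, hpr (envL 𝕜 a * envR 𝕜 b)⟩ : UnivForms 𝕜 (QSphere 𝕜 N q)) =
          envL 𝕜 a • univD 𝕜 _ b := by
        apply Subtype.ext
        simp only [envMul_apply, map_mul, Submodule.coe_smul, univD, smul_eq_mul, LinearMap.coe_mk,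
          AddHom.coe_mk, mul_sub]
      rw [this, map_smul]
      exact Submodule.smul_mem L a (hd b)
    | ha s t hs ht =>
      have : (⟨_, hpr (s + t)⟩ : UnivForms 𝕜 (QSphere 𝕜 N q)) = ⟨_, hpr s⟩ + ⟨_, hpr t⟩ := by
        apply Subtype.ext
        simp only [map_add, Submodule.coe_add]; abel
      rw [this, map_add]; exact add_mem hs ht
  rw [eq_top_iff]
  rintro w -
  obtain ⟨u, rfl⟩ := (Submodule.span (Env 𝕜 (QSphere 𝕜 N q))
      (Set.range fun p : Fin N × Fin N => gammaRel 𝕜 N q p.1 p.2)).mkQ_surjective w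
  have hu : envMul 𝕜 (QSphere 𝕜 N q) u.1 = 0 := u.2
  have : (⟨_, hpr u.1⟩ : UnivForms 𝕜 (QSphere 𝕜 N q)) = u := by
    apply Subtype.ext
    simp only [hu, map_zero, sub_zero]
  have h := hall u.1
  rw [this] at h
  exact h

/-- The forms `dx_i + a x_i H` generate the left module `Γ₊` if `1 + a ≠ 0`. -/
theorem span_gd_add (a : 𝕜) (ha : 1 + a ≠ 0) : Submodule.span (QSphere 𝕜 N q)
    (Set.range fun i => gd 𝕜 N q (qx 𝕜 N q i) + a • qx 𝕜 N q i • Hform 𝕜 N q) = ⊤ := by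
  set L := Submodule.span (QSphere 𝕜 N q)
    (Set.range fun i => gd 𝕜 N q (qx 𝕜 N q i) + a • qx 𝕜 N q i • Hform 𝕜 N q)
  have hg : ∀ i, gd 𝕜 N q (qx 𝕜 N q i) + a • qx 𝕜 N q i • Hform 𝕜 N q ∈ L :=
    fun i => Submodule.subset_span ⟨i, rfl⟩
  have hk : ∀ (r : 𝕜) w, w ∈ L → r • w ∈ L := fun r w h => Submodule.smul_of_tower_mem _ r h
  -- Since C^{kl} x_k x_l = 1, contraction recovers H from the generators as soon as 1 + a is
  -- invertible.
  have h1 : kCtr 𝕜 q (fun k l => qx 𝕜 N q k • (gd 𝕜 N q (qx 𝕜 N q l)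
      + a • qx 𝕜 N q l • Hform 𝕜 N q)) = (1 + a) • Hform 𝕜 N q := by
    rw [kCtr_add_smul, add_smul, one_smul]; rfl
  have hH : Hform 𝕜 N q ∈ L := by
    have h2 : (1 + a) • Hform 𝕜 N q ∈ L := by
      rw [← h1]
      exact sum_mem fun k _ => sum_mem fun l _ => hk _ _ (Submodule.smul_mem _ _ (hg l))
    have h3 := hk (1 + a)⁻¹ _ h2
    rwa [smul_smul, inv_mul_cancel₀ ha, one_smul] at h3
  rw [eq_top_iff, ← span_gd, Submodule.span_le]
  rintro _ ⟨i, rfl⟩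
  have := sub_mem (hg i) (hk a _ (Submodule.smul_mem _ (qx 𝕜 N q i) hH))
  rwa [add_sub_cancel_right] at this

end FormCoordinates

/-! ### Universal property and actions of the balanced tensor product. -/

section TensorLift

variable {k : Type*} [Field k] {X : Type*} [Ring X] [Algebra k X]
variable {M : Type*} [AddCommGroup M] [Module k M] [Module X M] [Module Xᵐᵒᵖ M]
variable {M' : Type*} [AddCommGroup M'] [Module k M'] [Module X M'] [Module Xᵐᵒᵖ M']
variable {T : Type*} [AddCommGroup T] [Module k T]

variable (k X) in
/-- The pure tensor as a bilinear map. -/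
def btmulₗ : M →ₗ[k] M' →ₗ[k] BTensor k X M M' :=
  (TensorProduct.mk k M M').compr₂ (BTensor.mk k X M M')

theorem btmulₗ_apply (m : M) (n : M') : btmulₗ k X m n = btmul k X m n := rfl

/-- A balanced bilinear map factors through the tensor product of bimodules. -/
theorem BTensor.exists_lift (B : M →ₗ[k] M' →ₗ[k] T)
    (hB : ∀ m (x : X) n, B (op x • m) n = B m (x • n)) :
    ∃ f : BTensor k X M M' →ₗ[k] T, ∀ m n, f (btmul k X m n) = B m n := by
  refine ⟨Submodule.liftQ (balancedRel k X M M') (TensorProduct.lift B) ?_, fun m n => ?_⟩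
  · rw [balancedRel, Submodule.span_le]
    rintro _ ⟨m, x, n, rfl⟩
    change TensorProduct.lift B _ = 0
    rw [map_sub, TensorProduct.lift.tmul, TensorProduct.lift.tmul, hB, sub_self]
  · exact TensorProduct.lift.tmul m n

variable [SMulCommClass X k M] [SMulCommClass X Xᵐᵒᵖ M]
variable [SMulCommClass Xᵐᵒᵖ k M'] [SMulCommClass X Xᵐᵒᵖ M']

instance BTensor.isScalarTower [IsScalarTower k X M] : IsScalarTower k X (BTensor k X M M') where
  smul_assoc c x t := by
    induction t using BTensor.induction with
    | h0 => simp only [smul_zero]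
    | ht m n =>
      rw [smul_btmul, smul_btmul, smul_assoc, ← btmulₗ_apply, map_smul]; rfl
    | ha s t hs ht => simp only [smul_add, hs, ht]

instance BTensor.isScalarTower_op [IsScalarTower k Xᵐᵒᵖ M'] :
    IsScalarTower k Xᵐᵒᵖ (BTensor k X M M') where
  smul_assoc c x t := by
    induction t using BTensor.induction with
    | h0 => simp only [smul_zero]
    | ht m n =>
      rw [← MulOpposite.op_unop (c • x), ← MulOpposite.op_unop x, op_smul_btmul, op_smul_btmul, MulOpposite.op_unop, smul_assoc,
        ← btmulₗ_apply, map_smul]; rfl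
    | ha s t hs ht => simp only [smul_add, hs, ht]

instance BTensor.smulCommClass_left : SMulCommClass X k (BTensor k X M M') where
  smul_comm x c t := (BTensor.lact k X x).map_smul c t

instance BTensor.smulCommClass_right : SMulCommClass Xᵐᵒᵖ k (BTensor k X M M') where
  smul_comm x c t := (BTensor.ract k X x).map_smul c t

instance BTensor.smulCommClass : SMulCommClass X Xᵐᵒᵖ (BTensor k X M M') where
  smul_comm x y t := by
    induction t using BTensor.induction with
    | h0 => simp only [smul_zero]
    | ht m n => rfl
    | ha s t hs ht => simp only [smul_add, hs, ht]

end TensorLift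

/-! ### Freeness of Γ on the γ⁺_i and existence of σ⁺. -/

section Braiding

variable {𝕜 : Type*} [RCLike 𝕜] {N : ℕ} {q : ℝ}

theorem gtmul_kRop_left (f : Fin N → Fin N → Gam 𝕜 N q) (w : Gam 𝕜 N q) (i j : Fin N) :
    gtmul 𝕜 N q (kRop 𝕜 q f i j) w = kRop 𝕜 q (fun a b => gtmul 𝕜 N q (f a b) w) i j :=
  map_kRop ((btmulₗ 𝕜 (QSphere 𝕜 N q)).flip w) f i j

theorem gtmul_kRop_right (f : Fin N → Fin N → Gam 𝕜 N q) (w : Gam 𝕜 N q) (i j : Fin N) :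
    gtmul 𝕜 N q w (kRop 𝕜 q f i j) = kRop 𝕜 q (fun a b => gtmul 𝕜 N q w (f a b)) i j :=
  map_kRop (btmulₗ 𝕜 (QSphere 𝕜 N q) w) f i j

theorem smul_gtmul (x : QSphere 𝕜 N q) (v w : Gam 𝕜 N q) :
    x • gtmul 𝕜 N q v w = gtmul 𝕜 N q (x • v) w := rfl

theorem op_smul_gtmul (x : QSphere 𝕜 N q) (v w : Gam 𝕜 N q) :
    op x • gtmul 𝕜 N q v w = gtmul 𝕜 N q v (op x • w) := rfl

theorem gtmul_smul (x : QSphere 𝕜 N q) (v w : Gam 𝕜 N q) :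
    gtmul 𝕜 N q v (x • w) = gtmul 𝕜 N q (op x • v) w :=
  (btmul_balanced 𝕜 _ v x w).symm

/-- The calculus `Γ₊` is a free left module with basis `γ⁺_i`, and right multiplication is given
by the R-matrix. -/
theorem exists_coord_gammaP (hq : 0 < q) (hN : 2 ≤ N) (hq1 : q ≠ 1) :
    ∃ c : Gam 𝕜 N q →ₗ[QSphere 𝕜 N q] (Fin N → QSphere 𝕜 N q),
      (∀ x w, c (op x • w) = rightOp hq x (c w)) ∧
      (∀ i, c (gammaP 𝕜 N q i) = unitVec 𝕜 N q i) ∧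
      Function.Injective c ∧
      Submodule.span (QSphere 𝕜 N q) (Set.range (gammaP 𝕜 N q)) = ⊤ := by
  obtain ⟨c, hc, b, hb, h1, h2, h3⟩ := exists_coord (𝕜 := 𝕜) (N := N) hq hN hq1
  have hH : c (Hform 𝕜 N q) = freeOmega 𝕜 N q + (b : 𝕜) • freeOmega 𝕜 N q := by
    have := map_left_kCtr c (fun k l => qx 𝕜 N q k • gd 𝕜 N q (qx 𝕜 N q l))
    simp only [map_smul, h3] at this
    rw [kCtr_add_smul] at this
    exact this
  have h2' := congrArg (RCLike.ofReal (K := 𝕜)) h2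
  have hg : ∀ i, c (gammaP 𝕜 N q i) = unitVec 𝕜 N q i := by
    intro i
    rw [gammaP, map_add, h3, LinearMap.map_smul_of_tower, map_smul, hH, smul_add,
      smul_comm (qx 𝕜 N q i) (_ : 𝕜)]
    push_cast at h2' ⊢
    generalize qx 𝕜 N q i • freeOmega 𝕜 N q = A
    match_scalars
    · rfl
    · linear_combination h2'
  have hs : Submodule.span (QSphere 𝕜 N q) (Set.range (gammaP 𝕜 N q)) = ⊤ := by
    refine span_gd_add _ ?_
    have e : (1 + -((1 + q ^ ((N : ℤ) - 2)) / (1 - q ^ ((N : ℤ) - 1)))) * (1 + b) = 1 := by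
      linear_combination h2
    have e' := left_ne_zero_of_mul_eq_one e
    intro h
    exact e' (by exact_mod_cast h)
  -- Both sides are left linear in w and agree on the generators, so c has a left inverse.
  have hd : ∀ w, w = ∑ i, c w i • gammaP 𝕜 N q i := by
    intro w
    have hw : w ∈ Submodule.span (QSphere 𝕜 N q) (Set.range (gammaP 𝕜 N q)) := by
      rw [hs]; trivial
    induction hw using Submodule.span_induction with
    | mem w h =>
      obtain ⟨i, rfl⟩ := h
      rw [hg, Finset.sum_eq_single i]
      · simp
      · intro j _ hj; simp [hj]
      · simp
    | zero => simp
    | add x y _ _ hx hy =>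
      nth_rw 1 [hx, hy]
      simp only [map_add, Pi.add_apply, add_smul, Finset.sum_add_distrib]
    | smul a x _ hx =>
      nth_rw 1 [hx]
      simp only [map_smul, Pi.smul_apply, smul_eq_mul, mul_smul, Finset.smul_sum]
  refine ⟨c, hc, hg, fun w w' h => ?_, hs⟩
  rw [hd w, hd w', h]

theorem op_smul_gammaP (hq : 0 < q) (hN : 2 ≤ N) (hq1 : q ≠ 1) (i j : Fin N) :
    op (qx 𝕜 N q j) • gammaP 𝕜 N q i =
      kRop 𝕜 q (fun k l => qx 𝕜 N q k • gammaP 𝕜 N q l) i j := by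
  obtain ⟨c, hc, hg, hi, -⟩ := exists_coord_gammaP (𝕜 := 𝕜) hq hN hq1
  apply hi
  rw [hc, hg, map_left_kRop, rightOp_qx, rightGen_single]
  simp only [map_smul, hg]

theorem free_induction {p : (Fin N → QSphere 𝕜 N q) → Prop} (h0 : p 0)
    (hs : ∀ (x : QSphere 𝕜 N q) v, p v → p (x • v)) (ha : ∀ v w, p v → p w → p (v + w))
    (hu : ∀ i, p (unitVec 𝕜 N q i)) (v) : p v := by
  have : v = ∑ i, v i • unitVec 𝕜 N q i := by
    funext j
    simp [Finset.sum_apply, Pi.single_apply]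
  rw [this]
  exact Finset.sum_induction _ p ha h0 fun i _ => hs _ _ (hu i)

variable (s : Fin N → Fin N → Gam2 𝕜 N q)

/-- The left linear map with `e_i ↦ s_{ij}`. -/
def constrLeft (j : Fin N) : (Fin N → QSphere 𝕜 N q) →ₗ[QSphere 𝕜 N q] Gam2 𝕜 N q :=
  (Pi.basisFun (QSphere 𝕜 N q) (Fin N)).constr 𝕜 fun i => s i j

theorem constrLeft_unitVec (i j : Fin N) : constrLeft s j (unitVec 𝕜 N q i) = s i j := by
  have := (Pi.basisFun (QSphere 𝕜 N q) (Fin N)).constr_basis 𝕜 (fun i => s i j) i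
  rwa [Pi.basisFun_apply] at this

/-- The map with `v ⊗ e_j ↦ s_j (v)` on the tensor square of the free bimodule. -/
def tensorMap (hq : 0 < q) (w : Fin N → QSphere 𝕜 N q) :
    (Fin N → QSphere 𝕜 N q) →ₗ[QSphere 𝕜 N q] Gam2 𝕜 N q :=
  ∑ j, (constrLeft s j).comp (rightOp hq (w j))

theorem tensorMap_apply (hq : 0 < q) (w v : Fin N → QSphere 𝕜 N q) :
    tensorMap s hq w v = ∑ j, constrLeft s j (rightOp hq (w j) v) := by
  simp [tensorMap]

theorem tensorMap_add (hq : 0 < q) (w w' v : Fin N → QSphere 𝕜 N q) :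
    tensorMap s hq (w + w') v = tensorMap s hq w v + tensorMap s hq w' v := by
  simp only [tensorMap_apply, Pi.add_apply, rightOp_add, map_add, Finset.sum_add_distrib]

theorem tensorMap_smul (hq : 0 < q) (c : 𝕜) (w v : Fin N → QSphere 𝕜 N q) :
    tensorMap s hq (c • w) v = c • tensorMap s hq w v := by
  simp only [tensorMap_apply, Pi.smul_apply, rightOp_smul, LinearMap.map_smul_of_tower,
    Finset.smul_sum]

/-- The balance condition needed to descend to the tensor product over X. -/
theorem tensorMap_left_smul (hq : 0 < q) (x : QSphere 𝕜 N q) (w v : Fin N → QSphere 𝕜 N q) :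
    tensorMap s hq (x • w) v = tensorMap s hq w (rightOp hq x v) := by
  simp only [tensorMap_apply, Pi.smul_apply, smul_eq_mul, rightOp_mul]

theorem rightOp_zero (hq : 0 < q) (v : Fin N → QSphere 𝕜 N q) : rightOp hq 0 v = 0 := by
  simp [rightOp]

theorem tensorMap_zero (hq : 0 < q) (v : Fin N → QSphere 𝕜 N q) : tensorMap s hq 0 v = 0 := by
  simp [tensorMap_apply, rightOp_zero]

theorem tensorMap_unitVec (hq : 0 < q) (j : Fin N) (v : Fin N → QSphere 𝕜 N q) :
    tensorMap s hq (unitVec 𝕜 N q j) v = constrLeft s j v := by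
  rw [tensorMap_apply, Finset.sum_eq_single j]
  · simp [rightOp_one]
  · intro i _ hi; simp [hi, rightOp_zero]
  · simp

/-- `hs` is right linearity tested on basis tensors and generators x_p. It extends to all v by left
linearity and to all w by moving the coefficients of w onto v. -/
theorem tensorMap_rightOp (hq : 0 < q)
    (hs : ∀ i l p, kRop 𝕜 q (fun m n => kRop 𝕜 q (fun a b => qx 𝕜 N q a • s b n) i m) l p =
      op (qx 𝕜 N q p) • s i l) (x : QSphere 𝕜 N q) (w v : Fin N → QSphere 𝕜 N q) :
    tensorMap s hq (rightOp hq x w) v = op x • tensorMap s hq w v := by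
  induction x using QSphere.induction generalizing w with
  | h1 => rw [rightOp_one, MulOpposite.op_one, one_smul]
  | hx p =>
    rw [rightOp_qx]
    induction w using free_induction generalizing v with
    | h0 => rw [map_zero, tensorMap_zero, smul_zero]
    | hs x w ih => rw [map_smul, tensorMap_left_smul, tensorMap_left_smul, ih]
    | ha w w' ih ih' => rw [map_add, tensorMap_add, tensorMap_add, ih, ih', smul_add]
    | hu l =>
      induction v using free_induction with
      | h0 => rw [map_zero, map_zero, smul_zero]
      | hs x v ih => rw [map_smul, map_smul, ih, smul_comm]
      | ha v v' ih ih' => rw [map_add, map_add, ih, ih', smul_add]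
      | hu i =>
        let W : (Fin N → QSphere 𝕜 N q) →ₗ[𝕜] Gam2 𝕜 N q :=
          { toFun := fun w => tensorMap s hq w (unitVec 𝕜 N q i)
            map_add' := fun w w' => tensorMap_add s hq w w' _
            map_smul' := fun c w => tensorMap_smul s hq c w _ }
        have hW : ∀ w, tensorMap s hq w (unitVec 𝕜 N q i) = W w := fun _ => rfl
        rw [rightGen_single, hW, map_kRop, tensorMap_unitVec, constrLeft_unitVec, ← hs]
        simp only [← hW, tensorMap_left_smul, tensorMap_unitVec, rightOp_qx, rightGen_single,
          map_left_kRop, map_smul, constrLeft_unitVec]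
  | hs c x ih => rw [rightOp_smul, tensorMap_smul, ih, MulOpposite.op_smul, smul_assoc]
  | ha x y ihx ihy => rw [rightOp_add, tensorMap_add, ihx, ihy, MulOpposite.op_add, add_smul]
  | hm x y ihx ihy => rw [rightOp_mul, ihy, ihx, smul_smul, MulOpposite.op_mul]

theorem exists_braiding_gammaP (hq : 0 < q) (hN : 2 ≤ N) (hq1 : q ≠ 1) (α : ℝ) :
    ∃ σ, IsBraidingFor 𝕜 N q α (gammaP 𝕜 N q) σ := by
  obtain ⟨c, hc, hg, -, -⟩ := exists_coord_gammaP (𝕜 := 𝕜) hq hN hq1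
  let γ := gammaP 𝕜 N q
  let s : Fin N → Fin N → Gam2 𝕜 N q := fun i j =>
    (α : 𝕜) • kSop 𝕜 q (fun k l => gtmul 𝕜 N q (γ k) (γ l)) i j
  have hs : ∀ i l p, kRop 𝕜 q (fun m n => kRop 𝕜 q (fun a b => qx 𝕜 N q a • s b n) i m) l p =
      op (qx 𝕜 N q p) • s i l := by
    intro i l p
    have hγ : ∀ k l, op (qx 𝕜 N q p) • gtmul 𝕜 N q (γ k) (γ l) =
        kRop 𝕜 q (fun c d => kRop 𝕜 q (fun g h => qx 𝕜 N q g • gtmul 𝕜 N q (γ h) (γ d)) k c)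
          l p := by
      intro k l
      rw [op_smul_gtmul, op_smul_gammaP hq hN hq1, gtmul_kRop_right]
      simp only [gtmul_smul, op_smul_gammaP hq hN hq1, gtmul_kRop_left, smul_gtmul, γ]
    simp only [s, smul_comm _ (α : 𝕜), ← smul_kRop]
    rw [smul_kSop]
    simp only [hγ, smul_kSop]
    rw [← smul_kSop (α : 𝕜), kSop_braid_left hq (fun g h d => qx 𝕜 N q g • gtmul 𝕜 N q (γ h) (γ d))]
  let B : Gam 𝕜 N q →ₗ[𝕜] Gam 𝕜 N q →ₗ[𝕜] Gam2 𝕜 N q :=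
    LinearMap.mk₂ 𝕜 (fun a b => tensorMap s hq (c b) (c a))
      (fun a a' b => by rw [map_add, map_add])
      (fun r a b => by rw [LinearMap.map_smul_of_tower, LinearMap.map_smul_of_tower])
      (fun a b b' => by rw [map_add, tensorMap_add])
      (fun r a b => by rw [LinearMap.map_smul_of_tower, tensorMap_smul])
  obtain ⟨σ, hσ⟩ := BTensor.exists_lift (X := QSphere 𝕜 N q) B (fun a x b => by
    change tensorMap s hq (c b) (c (op x • a)) = tensorMap s hq (c (x • b)) (c a)
    rw [hc, map_smul, tensorMap_left_smul])
  have hσ' : ∀ a b, σ (gtmul 𝕜 N q a b) = tensorMap s hq (c b) (c a) := hσ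
  refine ⟨σ, ⟨fun x t => ?_, fun x t => ?_, fun i j => ?_⟩⟩
  · induction t using BTensor.induction with
    | h0 => simp only [smul_zero, map_zero]
    | ht a b => rw [smul_btmul, hσ', hσ', map_smul, map_smul]
    | ha t t' h h' => rw [smul_add, map_add, h, h', map_add, smul_add]
  · induction t using BTensor.induction with
    | h0 => simp only [smul_zero, map_zero]
    | ht a b => rw [op_smul_btmul, hσ', hσ', hc, tensorMap_rightOp s hq hs]
    | ha t t' h h' => rw [smul_add, map_add, h, h', map_add, smul_add]
  · rw [hσ', hg, hg, tensorMap_unitVec, constrLeft_unitVec]; rfl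

end Braiding

/-! ### Values of σ⁺ on tensors involving ω⁺. -/

section Comparison

variable {𝕜 : Type*} [RCLike 𝕜] {N : ℕ} {q : ℝ}

/-- The witness is c = −(1 + q^{N−2})/q^{N−2}. The third identity says γ⁻_i = γ⁺_i + c x_i ω⁺,
because ω⁺ = (1 + α⁺)H; the last one makes the γ⁻_i generate Γ. -/
theorem gammaM_facts (hq : 0 < q) (hN : 2 ≤ N) (hq1 : q ≠ 1) :
    ∃ c : ℝ, c * kap N q = -(q - q⁻¹) ∧ (1 + c) * (q⁻¹ * q ^ N) = -q ∧
      q * ((1 + q ^ ((N : ℤ) - 2)) / (1 - q ^ ((N : ℤ) - 1))) =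
        -((1 + q ^ ((N : ℤ) - 2)) / (1 - q ^ ((N : ℤ) - 1)))
        + c * (1 + -((1 + q ^ ((N : ℤ) - 2)) / (1 - q ^ ((N : ℤ) - 1)))) ∧
      1 + q * ((1 + q ^ ((N : ℤ) - 2)) / (1 - q ^ ((N : ℤ) - 1))) ≠ 0 := by
  obtain ⟨P, hP, hP1, h2, h1, h3, h4⟩ := zpow_facts hq hN hq1
  have h6 : 1 - q * P ≠ 0 := fun h => hP1 (by linarith)
  have h7 : 1 + P ≠ 0 := by positivity
  rw [zpow_natCast] at h4
  refine ⟨-(1 + P) / P, ?_, ?_, ?_, ?_⟩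
  · rw [kap, h1, h2, h3]; field_simp
  · rw [h4]; field_simp; ring
  · rw [h1, h2]; field_simp; ring
  · rw [h1, h2]
    have e : 1 + q * ((1 + P) / (1 - q * P)) = (1 + q) / (1 - q * P) := by field_simp; ring
    rw [e]; exact div_ne_zero (by positivity) h6

variable (𝕜 N q) in
/-- The one-form `C^{kl} x_k γ⁺_l`. -/
def omegaP : Gam 𝕜 N q := kCtr 𝕜 q fun k l => qx 𝕜 N q k • gammaP 𝕜 N q l

theorem omegaP_eq : omegaP 𝕜 N q = Hform 𝕜 N q
    + ((-((1 + q ^ ((N : ℤ) - 2)) / (1 - q ^ ((N : ℤ) - 1))) : ℝ) : 𝕜) • Hform 𝕜 N q :=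
  kCtr_add_smul _ _ _

theorem op_smul_omegaP (hq : 0 < q) (hN : 2 ≤ N) (hq1 : q ≠ 1) (j : Fin N) :
    op (qx 𝕜 N q j) • omegaP 𝕜 N q =
      ((q⁻¹ : ℝ) : 𝕜) • qx 𝕜 N q j • omegaP 𝕜 N q + (kap N q : 𝕜) • gammaP 𝕜 N q j := by
  obtain ⟨c, hc, hg, hi, -⟩ := exists_coord_gammaP (𝕜 := 𝕜) hq hN hq1
  have h : c (omegaP 𝕜 N q) = freeOmega 𝕜 N q := by
    rw [omegaP, map_left_kCtr]
    simp only [map_smul, hg]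
    rfl
  apply hi
  rw [hc, h, rightOp_qx, rightGen_freeOmega hq, map_add, LinearMap.map_smul_of_tower, map_smul,
    LinearMap.map_smul_of_tower, h, hg]

theorem gammaM_eq {c : ℝ} (hc : q * ((1 + q ^ ((N : ℤ) - 2)) / (1 - q ^ ((N : ℤ) - 1))) =
    -((1 + q ^ ((N : ℤ) - 2)) / (1 - q ^ ((N : ℤ) - 1)))
      + c * (1 + -((1 + q ^ ((N : ℤ) - 2)) / (1 - q ^ ((N : ℤ) - 1))))) (i : Fin N) :
    gammaM 𝕜 N q i = gammaP 𝕜 N q i + (c : 𝕜) • qx 𝕜 N q i • omegaP 𝕜 N q := by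
  have hc' := congrArg (RCLike.ofReal (K := 𝕜)) hc
  rw [gammaM, gammaP, omegaP_eq, smul_add, smul_comm (qx 𝕜 N q i) (_ : 𝕜)]
  generalize (1 + q ^ ((N : ℤ) - 2)) / (1 - q ^ ((N : ℤ) - 1)) = a at hc'
  push_cast at hc' ⊢
  generalize qx 𝕜 N q i • Hform 𝕜 N q = A
  match_scalars
  · rfl
  · linear_combination hc'

theorem kCtr_qx_smul_qx_smul {E : Type*} [AddCommGroup E] [Module 𝕜 E] [Module (QSphere 𝕜 N q) E]
    [IsScalarTower 𝕜 (QSphere 𝕜 N q) E] (v : E) :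
    kCtr 𝕜 q (fun k l => qx 𝕜 N q k • qx 𝕜 N q l • v) = v := by
  have h := map_left_kCtr (LinearMap.toSpanSingleton (QSphere 𝕜 N q) E v)
    (fun k l => qx 𝕜 N q k * qx 𝕜 N q l)
  simp only [LinearMap.toSpanSingleton_apply, mul_smul] at h
  rw [← h, kCtr_qx_mul_qx, one_smul]

theorem gtmul_kCtr_left (f : Fin N → Fin N → Gam 𝕜 N q) (w : Gam 𝕜 N q) :
    gtmul 𝕜 N q (kCtr 𝕜 q f) w = kCtr 𝕜 q (fun a b => gtmul 𝕜 N q (f a b) w) :=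
  map_kCtr ((btmulₗ 𝕜 (QSphere 𝕜 N q)).flip w) f

theorem gtmul_kCtr_right (f : Fin N → Fin N → Gam 𝕜 N q) (w : Gam 𝕜 N q) :
    gtmul 𝕜 N q w (kCtr 𝕜 q f) = kCtr 𝕜 q (fun a b => gtmul 𝕜 N q w (f a b)) :=
  map_kCtr (btmulₗ 𝕜 (QSphere 𝕜 N q) w) f

theorem gtmul_add_left (v v' w : Gam 𝕜 N q) :
    gtmul 𝕜 N q (v + v') w = gtmul 𝕜 N q v w + gtmul 𝕜 N q v' w := btmul_add_left _ _ _ _ _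

theorem gtmul_add_right (v w w' : Gam 𝕜 N q) :
    gtmul 𝕜 N q v (w + w') = gtmul 𝕜 N q v w + gtmul 𝕜 N q v w' := btmul_add_right _ _ _ _ _

theorem gtmul_ksmul_left (c : 𝕜) (v w : Gam 𝕜 N q) :
    gtmul 𝕜 N q (c • v) w = c • gtmul 𝕜 N q v w :=
  map_smul ((btmulₗ 𝕜 (QSphere 𝕜 N q)).flip w) c v

theorem gtmul_ksmul_right (c : 𝕜) (v w : Gam 𝕜 N q) :
    gtmul 𝕜 N q v (c • w) = c • gtmul 𝕜 N q v w :=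
  map_smul (btmulₗ 𝕜 (QSphere 𝕜 N q) v) c w

variable (𝕜 N q) in
/-- The two-form `C^{kl} γ⁺_k ⊗ γ⁺_l`. -/
def OmegaP : Gam2 𝕜 N q := kCtr 𝕜 q fun k l => gtmul 𝕜 N q (gammaP 𝕜 N q k) (gammaP 𝕜 N q l)

theorem kCtr_smul_kSop_gammaP (hq : 0 < q) (hN : 2 ≤ N) (hq1 : q ≠ 1) (j : Fin N) :
    kCtr 𝕜 q (fun k l => qx 𝕜 N q k •
      kSop 𝕜 q (fun m n => gtmul 𝕜 N q (gammaP 𝕜 N q m) (gammaP 𝕜 N q n)) l j) =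
      gtmul 𝕜 N q (gammaP 𝕜 N q j) (omegaP 𝕜 N q) := by
  simp only [smul_kSop]
  rw [kCtr_kSop_slide hq (fun k m n => qx 𝕜 N q k •
    gtmul 𝕜 N q (gammaP 𝕜 N q m) (gammaP 𝕜 N q n)), omegaP, gtmul_kCtr_right]
  simp only [gtmul_smul, op_smul_gammaP hq hN hq1, gtmul_kRop_left, smul_gtmul]

theorem omegaP_gtmul (w : Gam 𝕜 N q) : gtmul 𝕜 N q (omegaP 𝕜 N q) w =
    kCtr 𝕜 q (fun k l => qx 𝕜 N q k • gtmul 𝕜 N q (gammaP 𝕜 N q l) w) := by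
  rw [omegaP, gtmul_kCtr_left]; rfl

/-- Write x_k ω⁺ = q(ω⁺ x_k − κ γ⁺_k) and move x_k across the tensor sign. -/
theorem kCtr_smul_omegaP_gtmul (hq : 0 < q) (hN : 2 ≤ N) (hq1 : q ≠ 1) :
    kCtr 𝕜 q (fun k l => qx 𝕜 N q k • gtmul 𝕜 N q (omegaP 𝕜 N q) (gammaP 𝕜 N q l)) =
      (q : 𝕜) • (gtmul 𝕜 N q (omegaP 𝕜 N q) (omegaP 𝕜 N q) - (kap N q : 𝕜) • OmegaP 𝕜 N q) := by
  have hq0 : (q : 𝕜) ≠ 0 := by exact_mod_cast hq.ne'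
  have e : ∀ k, qx 𝕜 N q k • omegaP 𝕜 N q = (q : 𝕜) • op (qx 𝕜 N q k) • omegaP 𝕜 N q
      + (-((q : 𝕜) * (kap N q : 𝕜))) • gammaP 𝕜 N q k := by
    intro k
    rw [op_smul_omegaP hq hN hq1]
    generalize qx 𝕜 N q k • omegaP 𝕜 N q = A
    push_cast
    match_scalars
    · field_simp
    · ring
  simp only [smul_gtmul, e, gtmul_add_left, gtmul_ksmul_left]
  rw [kCtr_add, ← smul_kCtr, ← smul_kCtr]
  simp only [← gtmul_smul]
  rw [← gtmul_kCtr_right]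
  change (q : 𝕜) • gtmul 𝕜 N q (omegaP 𝕜 N q) (omegaP 𝕜 N q) + _ • OmegaP 𝕜 N q = _
  module

section

variable {α : ℝ} {σ : Gam2 𝕜 N q →ₗ[𝕜] Gam2 𝕜 N q}

theorem IsBraidingFor.gammaP_gammaP (hσ : IsBraidingFor 𝕜 N q α (gammaP 𝕜 N q) σ) (i j : Fin N) :
    σ (gtmul 𝕜 N q (gammaP 𝕜 N q i) (gammaP 𝕜 N q j)) = (α : 𝕜) •
      kSop 𝕜 q (fun m n => gtmul 𝕜 N q (gammaP 𝕜 N q m) (gammaP 𝕜 N q n)) i j :=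
  hσ.map_basis i j

theorem IsBraidingFor.omegaP_gammaP (hq : 0 < q) (hN : 2 ≤ N) (hq1 : q ≠ 1)
    (hσ : IsBraidingFor 𝕜 N q α (gammaP 𝕜 N q) σ) (j : Fin N) :
    σ (gtmul 𝕜 N q (omegaP 𝕜 N q) (gammaP 𝕜 N q j)) =
      (α : 𝕜) • gtmul 𝕜 N q (gammaP 𝕜 N q j) (omegaP 𝕜 N q) := by
  rw [omegaP_gtmul, map_kCtr]
  simp only [hσ.map_left, hσ.gammaP_gammaP, smul_comm (qx 𝕜 N q _) (α : 𝕜)]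
  rw [← smul_kCtr, kCtr_smul_kSop_gammaP hq hN hq1]

theorem IsBraidingFor.gammaP_omegaP (hq : 0 < q) (hN : 2 ≤ N) (hq1 : q ≠ 1)
    (hσ : IsBraidingFor 𝕜 N q α (gammaP 𝕜 N q) σ) (l : Fin N) :
    σ (gtmul 𝕜 N q (gammaP 𝕜 N q l) (omegaP 𝕜 N q)) = (α : 𝕜) •
      (gtmul 𝕜 N q (omegaP 𝕜 N q) (gammaP 𝕜 N q l)
        + (-((q - q⁻¹ : ℝ) : 𝕜)) • gtmul 𝕜 N q (gammaP 𝕜 N q l) (omegaP 𝕜 N q)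
        + ((q - q⁻¹ : ℝ) : 𝕜) • ((q⁻¹ * q ^ N : ℝ) : 𝕜) • qx 𝕜 N q l • OmegaP 𝕜 N q) := by
  let S : Fin N → Fin N → Gam2 𝕜 N q :=
    kSop 𝕜 q fun m n => gtmul 𝕜 N q (gammaP 𝕜 N q m) (gammaP 𝕜 N q n)
  have hS : ∀ i j, σ (gtmul 𝕜 N q (gammaP 𝕜 N q i) (gammaP 𝕜 N q j)) = (α : 𝕜) • S i j :=
    hσ.map_basis
  -- R̂⁻² = I − (q − q⁻¹)R̂⁻¹ + (q − q⁻¹)q^{N−1}K. The square occurs because σ contributes one R̂⁻¹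
  -- and sliding the crossing in `h1` through the metric contributes another.
  have e : ∀ a b, kSop 𝕜 q S a b = gtmul 𝕜 N q (gammaP 𝕜 N q a) (gammaP 𝕜 N q b)
      + (-((q - q⁻¹ : ℝ) : 𝕜)) • S a b
      + ((q - q⁻¹ : ℝ) : 𝕜) • (Cmat N q a b : 𝕜) • ((q⁻¹ * q ^ N : ℝ) : 𝕜) • OmegaP 𝕜 N q := by
    intro a b
    rw [kSop_eq, kRop_kSop hq, kCtr_kSop hq, neg_smul, ← sub_eq_add_neg]; rfl
  have h1 : gtmul 𝕜 N q (gammaP 𝕜 N q l) (omegaP 𝕜 N q) = kCtr 𝕜 q (fun m n => kRop 𝕜 q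
      (fun a b => qx 𝕜 N q a • gtmul 𝕜 N q (gammaP 𝕜 N q b) (gammaP 𝕜 N q n)) l m) := by
    rw [omegaP, gtmul_kCtr_right]
    simp only [gtmul_smul, op_smul_gammaP hq hN hq1, gtmul_kRop_left, smul_gtmul]
  nth_rw 1 [h1]
  rw [map_kCtr]
  simp only [map_kRop, hσ.map_left, hS, smul_comm (qx 𝕜 N q _) (α : 𝕜), ← smul_kRop,
    ← smul_kCtr (α : 𝕜)]
  congr 1
  rw [← kCtr_kSop_slide hq (fun a b n => qx 𝕜 N q a • S b n)]
  simp only [← smul_kSop]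
  rw [show (fun k j => qx 𝕜 N q k • kSop 𝕜 q (fun m n => S m n) j l) = fun k j =>
    qx 𝕜 N q k • gtmul 𝕜 N q (gammaP 𝕜 N q j) (gammaP 𝕜 N q l)
      + (-((q - q⁻¹ : ℝ) : 𝕜)) • qx 𝕜 N q k • S j l
      + ((q - q⁻¹ : ℝ) : 𝕜) • ((q⁻¹ * q ^ N : ℝ) : 𝕜) • (Cmat N q j l : 𝕜) • qx 𝕜 N q k •
        OmegaP 𝕜 N q from by
    funext k j
    rw [e j l]
    simp only [smul_add, smul_comm (qx 𝕜 N q k) (_ : 𝕜)]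
    rw [smul_comm (Cmat N q j l : 𝕜)]]
  rw [kCtr_add, kCtr_add, ← smul_kCtr, ← smul_kCtr, ← smul_kCtr, kCtr_Cmat_left hq, ← omegaP_gtmul,
    kCtr_smul_kSop_gammaP hq hN hq1]

theorem IsBraidingFor.omegaP_omegaP (hq : 0 < q) (hN : 2 ≤ N) (hq1 : q ≠ 1)
    (hσ : IsBraidingFor 𝕜 N q α (gammaP 𝕜 N q) σ) :
    σ (gtmul 𝕜 N q (omegaP 𝕜 N q) (omegaP 𝕜 N q)) = (α : 𝕜) •
      ((q : 𝕜) • (gtmul 𝕜 N q (omegaP 𝕜 N q) (omegaP 𝕜 N q) - (kap N q : 𝕜) • OmegaP 𝕜 N q)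
        + (-((q - q⁻¹ : ℝ) : 𝕜)) • gtmul 𝕜 N q (omegaP 𝕜 N q) (omegaP 𝕜 N q)
        + ((q - q⁻¹ : ℝ) : 𝕜) • ((q⁻¹ * q ^ N : ℝ) : 𝕜) • OmegaP 𝕜 N q) := by
  nth_rw 1 [omegaP_gtmul]
  rw [map_kCtr]
  simp only [hσ.map_left, hσ.gammaP_omegaP hq hN hq1, smul_comm (qx 𝕜 N q _) (_ : 𝕜), smul_add]
  simp only [kCtr_add, ← smul_kCtr (_ : 𝕜), kCtr_qx_smul_qx_smul, ← omegaP_gtmul,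
    kCtr_smul_omegaP_gtmul hq hN hq1]

end

end Comparison

/-! ### σ⁺ satisfies the equation for γ⁻, and uniqueness. -/

section Main

/-- The coefficient comparison behind σ⁺ = σ⁻, with p, r, Q standing for q, q⁻¹, q^N; the two
hypotheses on c are all it takes. -/
theorem combination_eq_combination {F E : Type*} [Field F] [AddCommGroup E] [Module F E]
    {a c p r Q κ : F} (hκ : c * κ = -(p - r)) (hQ : (1 + c) * (r * Q) = -p)
    (C : F) (A₁ A₂ A₃ A₄ A₅ A₆ A₇ B₁ B₂ : E) :
    a • A₁ + c • a • A₅ +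
          (c • a • A₂ + c • a • -(p - r) • A₃ +
            c • a • (p - r) • (r * Q) • (p • A₇ + (κ - (p - r)) • C • B₂)) +
        ((c * c * r) • a • p • A₆ - (c * c * r) • a • p • κ • A₇ +
            (c * c * r) • a • -(p - r) • A₆ + (c * c * r) • a • (p - r) • (r * Q) • A₇) +
      ((c * c * κ) • a • A₄ + (c * c * κ) • a • -(p - r) • A₅ +
        (c * c * κ) • a • (p - r) • (r * Q) • A₇) =
    a • A₁ + a • c • (A₂ - (p - r) • A₄ + (p - r) • C • p • (B₁ - κ • B₂)) + a • c • A₅ +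
        a • (c * c * r) • (r • A₆ + κ • C • B₁) +
      a • (c * c * κ) • (A₃ - (p - r) • A₅ + (p - r) • C • B₁) := by
  match_scalars
  · ring
  · ring
  · ring
  · linear_combination (-a * c) * hκ
  · linear_combination (a * c * (p - r) * r) * hQ +
      (a * c * (p - r) * (r * Q) - a * c * r * p) * hκ
  · linear_combination (a * c * (p - r) * C) * (κ * hQ - r * Q * hκ)
  · ring
  · linear_combination (a * c) * hκ
  · linear_combination (-a * c * C * p) * hκ

variable {𝕜 : Type*} [RCLike 𝕜] {N : ℕ} {q : ℝ}

/-- The braiding for the forms `γ⁺` is also a braiding for the forms `γ⁻`. -/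
theorem IsBraidingFor.gammaM (hq : 0 < q) (hN : 2 ≤ N) (hq1 : q ≠ 1) {α : ℝ}
    {σ : Gam2 𝕜 N q →ₗ[𝕜] Gam2 𝕜 N q} (hσ : IsBraidingFor 𝕜 N q α (gammaP 𝕜 N q) σ) :
    IsBraidingFor 𝕜 N q α (gammaM 𝕜 N q) σ := by
  refine ⟨hσ.map_left, hσ.map_right, fun i j => ?_⟩
  obtain ⟨c, h1, h2, h3, -⟩ := gammaM_facts hq hN hq1
  have h1' := congrArg (RCLike.ofReal (K := 𝕜)) h1
  have h2' := congrArg (RCLike.ofReal (K := 𝕜)) h2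
  have hR : ∀ i j, gtmul 𝕜 N q (gammaP 𝕜 N q i) (qx 𝕜 N q j • omegaP 𝕜 N q) =
      kRop 𝕜 q (fun k l => qx 𝕜 N q k • gtmul 𝕜 N q (gammaP 𝕜 N q l) (omegaP 𝕜 N q)) i j := by
    intro i j
    simp only [gtmul_smul, op_smul_gammaP hq hN hq1, gtmul_kRop_left, smul_gtmul]
  have hw : ∀ j, gtmul 𝕜 N q (omegaP 𝕜 N q) (qx 𝕜 N q j • omegaP 𝕜 N q) =
      ((q⁻¹ : ℝ) : 𝕜) • qx 𝕜 N q j • gtmul 𝕜 N q (omegaP 𝕜 N q) (omegaP 𝕜 N q)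
      + (kap N q : 𝕜) • gtmul 𝕜 N q (gammaP 𝕜 N q j) (omegaP 𝕜 N q) := by
    intro j
    rw [gtmul_smul, op_smul_omegaP hq hN hq1, gtmul_add_left, gtmul_ksmul_left, gtmul_ksmul_left]
    rfl
  have hMM : ∀ i j, gtmul 𝕜 N q (_root_.gammaM 𝕜 N q i) (_root_.gammaM 𝕜 N q j) =
      gtmul 𝕜 N q (gammaP 𝕜 N q i) (gammaP 𝕜 N q j)
      + (c : 𝕜) • qx 𝕜 N q i • gtmul 𝕜 N q (omegaP 𝕜 N q) (gammaP 𝕜 N q j)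
      + (c : 𝕜) • kRop 𝕜 q
        (fun k l => qx 𝕜 N q k • gtmul 𝕜 N q (gammaP 𝕜 N q l) (omegaP 𝕜 N q)) i j
      + ((c : 𝕜) * (c : 𝕜) * ((q⁻¹ : ℝ) : 𝕜)) •
        (qx 𝕜 N q i * qx 𝕜 N q j) • gtmul 𝕜 N q (omegaP 𝕜 N q) (omegaP 𝕜 N q)
      + ((c : 𝕜) * (c : 𝕜) * (kap N q : 𝕜)) •
        qx 𝕜 N q i • gtmul 𝕜 N q (gammaP 𝕜 N q j) (omegaP 𝕜 N q) := by
    intro i j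
    rw [gammaM_eq h3, gammaM_eq h3, gtmul_add_left, gtmul_add_right, gtmul_add_right,
      gtmul_ksmul_left, gtmul_ksmul_left, gtmul_ksmul_right, gtmul_ksmul_right, hR,
      ← smul_gtmul, ← smul_gtmul, hw]
    simp only [smul_add, smul_comm (qx 𝕜 N q _) (_ : 𝕜), mul_smul]
    abel
  -- The relation of X rewritten for R̂ instead of R̂⁻¹; here q⁻¹ + (q − q⁻¹) = q.
  have hxx : ∀ (v : Gam2 𝕜 N q), kRop 𝕜 q (fun k l => (qx 𝕜 N q k * qx 𝕜 N q l) • v) i j =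
      (q : 𝕜) • (qx 𝕜 N q i * qx 𝕜 N q j) • v
      + ((kap N q : 𝕜) - ((q - q⁻¹ : ℝ) : 𝕜)) • (Cmat N q i j : 𝕜) • v := by
    intro v
    have h := kSop_qx_mul_qx_smul (𝕜 := 𝕜) (N := N) (q := q) v i j
    have h' := kCtr_qx_smul_qx_smul (𝕜 := 𝕜) (N := N) (q := q) v
    simp only [smul_smul (qx 𝕜 N q _)] at h'
    rw [kSop_eq, h', sub_add, sub_eq_iff_eq_add] at h
    rw [h]
    generalize (qx 𝕜 N q i * qx 𝕜 N q j) • v = A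
    push_cast
    module
  change σ (gtmul 𝕜 N q _ _) = (α : 𝕜) • kSop 𝕜 q (fun k l =>
    gtmul 𝕜 N q (_root_.gammaM 𝕜 N q k) (_root_.gammaM 𝕜 N q l)) i j
  simp only [hMM, map_add, map_smul, map_kRop, hσ.map_left, hσ.gammaP_gammaP,
    hσ.gammaP_omegaP hq hN hq1, hσ.omegaP_gammaP hq hN hq1, hσ.omegaP_omegaP hq hN hq1, smul_add,
    smul_comm (qx 𝕜 N q _) (_ : 𝕜), smul_comm (_ * _ : QSphere 𝕜 N q) (_ : 𝕜), smul_sub, kRop_add, kSop_add,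
    ← smul_kRop (_ : 𝕜), ← smul_kSop (_ : 𝕜), kSop_kRop hq]
  generalize kSop 𝕜 q (fun k l => gtmul 𝕜 N q (gammaP 𝕜 N q k) (gammaP 𝕜 N q l)) i j = A₁
  simp only [smul_smul (qx 𝕜 N q _) (qx 𝕜 N q _), hxx, kSop_qx_mul_qx_smul]
  simp only [kSop_eq, kCtr_smul_omegaP_gtmul hq hN hq1, ← omegaP_gtmul]
  generalize kRop 𝕜 q (fun k l => qx 𝕜 N q k • gtmul 𝕜 N q (omegaP 𝕜 N q) (gammaP 𝕜 N q l))
    i j = A₂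
  generalize kRop 𝕜 q (fun k l => qx 𝕜 N q k • gtmul 𝕜 N q (gammaP 𝕜 N q l) (omegaP 𝕜 N q))
    i j = A₃
  generalize qx 𝕜 N q i • gtmul 𝕜 N q (omegaP 𝕜 N q) (gammaP 𝕜 N q j) = A₄
  generalize qx 𝕜 N q i • gtmul 𝕜 N q (gammaP 𝕜 N q j) (omegaP 𝕜 N q) = A₅
  generalize gtmul 𝕜 N q (omegaP 𝕜 N q) (omegaP 𝕜 N q) = B₁
  generalize OmegaP 𝕜 N q = B₂
  generalize (qx 𝕜 N q i * qx 𝕜 N q j) • B₁ = A₆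
  generalize (qx 𝕜 N q i * qx 𝕜 N q j) • B₂ = A₇
  push_cast at h1' h2' ⊢
  exact combination_eq_combination h1' h2' _ _ _ _ _ _ _ _ _ _

/-- A coefficient of the second factor crosses to the first as a right multiplication, which stays
in Γ; hence the induction on the second factor keeps the first one arbitrary. -/
theorem btmul_mem_span {γ : Fin N → Gam 𝕜 N q}
    (hγ : Submodule.span (QSphere 𝕜 N q) (Set.range γ) = ⊤) (t : Gam2 𝕜 N q) :
    t ∈ Submodule.span (QSphere 𝕜 N q)
      (Set.range fun p : Fin N × Fin N => gtmul 𝕜 N q (γ p.1) (γ p.2)) := by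
  have hm : ∀ w : Gam 𝕜 N q, w ∈ Submodule.span (QSphere 𝕜 N q) (Set.range γ) := fun w => by
    rw [hγ]; trivial
  have h1 : ∀ (j : Fin N) (w : Gam 𝕜 N q), gtmul 𝕜 N q w (γ j) ∈ Submodule.span (QSphere 𝕜 N q)
      (Set.range fun p : Fin N × Fin N => gtmul 𝕜 N q (γ p.1) (γ p.2)) := by
    intro j w
    induction hm w using Submodule.span_induction with
    | mem w h => obtain ⟨i, rfl⟩ := h; exact Submodule.subset_span ⟨(i, j), rfl⟩
    | zero => rw [gtmul, btmul_zero_left]; exact zero_mem _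
    | add a b _ _ ha hb => rw [gtmul_add_left]; exact add_mem ha hb
    | smul x w _ h => rw [← smul_gtmul]; exact Submodule.smul_mem _ _ h
  induction t using BTensor.induction with
  | h0 => exact zero_mem _
  | ht v w =>
    change gtmul 𝕜 N q v w ∈ _
    induction hm w using Submodule.span_induction generalizing v with
    | mem w h => obtain ⟨j, rfl⟩ := h; exact h1 j v
    | zero => rw [gtmul, btmul_zero_right]; exact zero_mem _
    | add a b _ _ ha hb => rw [gtmul_add_right]; exact add_mem (ha v) (hb v)
    | smul x w _ h => rw [gtmul_smul]; exact h _
  | ha s t hs ht => exact add_mem hs ht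

theorem IsBraidingFor.unique {α : ℝ} {γ : Fin N → Gam 𝕜 N q}
    (hγ : Submodule.span (QSphere 𝕜 N q) (Set.range γ) = ⊤)
    {σ τ : Gam2 𝕜 N q →ₗ[𝕜] Gam2 𝕜 N q} (hσ : IsBraidingFor 𝕜 N q α γ σ)
    (hτ : IsBraidingFor 𝕜 N q α γ τ) : σ = τ := by
  ext t
  induction btmul_mem_span hγ t using Submodule.span_induction with
  | mem t h => obtain ⟨p, rfl⟩ := h; exact (hσ.map_basis _ _).trans (hτ.map_basis _ _).symm
  | zero => rw [map_zero, map_zero]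
  | add s t _ _ hs ht => rw [map_add, map_add, hs, ht]
  | smul x t _ h => rw [hσ.map_left, hτ.map_left, h]

theorem span_gammaM (hq : 0 < q) (hN : 2 ≤ N) (hq1 : q ≠ 1) :
    Submodule.span (QSphere 𝕜 N q) (Set.range (gammaM 𝕜 N q)) = ⊤ := by
  obtain ⟨c, -, -, -, h⟩ := gammaM_facts hq hN hq1
  exact span_gd_add _ fun h' => h (by exact_mod_cast h')

end Main

end

theorem mainTheorem11 (𝕜 : Type*) [RCLike 𝕜] (N : ℕ) (hN : 3 ≤ N) (q : ℝ) (hq : 0 < q)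
    (hq1 : q ≠ 1) (α : ℝ) :
    (∃! σ : Gam2 𝕜 N q →ₗ[𝕜] Gam2 𝕜 N q, IsBraidingFor 𝕜 N q α (gammaP 𝕜 N q) σ) ∧
    (∃! σ : Gam2 𝕜 N q →ₗ[𝕜] Gam2 𝕜 N q, IsBraidingFor 𝕜 N q α (gammaM 𝕜 N q) σ) ∧
    ∀ σp σm : Gam2 𝕜 N q →ₗ[𝕜] Gam2 𝕜 N q,
      IsBraidingFor 𝕜 N q α (gammaP 𝕜 N q) σp →
      IsBraidingFor 𝕜 N q α (gammaM 𝕜 N q) σm → σp = σm := by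
  have hN2 : 2 ≤ N := by omega
  obtain ⟨c, -, -, -, hP⟩ := exists_coord_gammaP (𝕜 := 𝕜) hq hN2 hq1
  have hM := span_gammaM (𝕜 := 𝕜) hq hN2 hq1
  obtain ⟨σ, hσ⟩ := exists_braiding_gammaP (𝕜 := 𝕜) hq hN2 hq1 α
  exact ⟨⟨σ, hσ, fun τ hτ => hτ.unique hP hσ⟩,
    ⟨σ, hσ.gammaM hq hN2 hq1, fun τ hτ => hτ.unique hM (hσ.gammaM hq hN2 hq1)⟩,
    fun σp σm hp hm => (hp.gammaM hq hN2 hq1).unique hM hm⟩
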